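/- Let $n\ge 2$ and let $C_{2n}=K_1\cup\dots\cup K_{2n}\subset\mathbb S^3$ be the minimally twisted $2n$-chain link: a closed chain of $2n$ unknotted circles, indexed cyclically mod $2n$, that lie alternately in the projection plane and perpendicular to it, each $K_j$ bounding a disk $D_j$ that meets the other components in one point of $K_{j-1}$ and one point of $K_{j+1}$. Let $A_i=D_i\setminus K_{i+1}$ and $A_{i+1}=D_{i+1}\setminus K_i$ (annuli). The $i$-th $ml$-swap $s_i$ is the composition of a right-handed Dehn twist along $A_i$, then a left-handed Dehn twist along $A_{i+1}$, then a right-handed Dehn twist along $A_i$; it is a self-homeomorphism of $\mathbb S^3\setminus(K_i\cup K_{i+1})$, and the link $C_{2n}'=s_i(C_{2n})$ that results from it has as components $K_i$, $K_{i+1}$ and the images $s_i(K_j)$, $j\ne i,i+1$. The swaps $s_i,s_j$ are non-overlapping if $|i-j|\ge 4$ mod $2n$. A non-overlapping nested partner of $C_{2n}$ is a link isotopic to the result of performing a finite sequence of pairwise non-overlapping $ml$-swaps on $C_{2n}$. For a sublink $L^*$ of a link $L=L_1\cup\dots\cup L_m\subset\mathbb S^3$, $0$-surgery on $L^*\subset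 L$ means: choose (smooth) closed tubular neighbourhoods $N_j$ of the components $L_j$, pairwise disjoint, with meridians and preferred (null-homologous in $\mathbb S^3\setminus L_j$) longitudes on $\partial N_j$; remove the interiors of all $N_j$, leaving the exterior $X$; glue in solid tori $V_j$ by homeomorphisms $\partial V_j\to\partial N_j$ that swap meridians and longitudes if $L_j\subset L^*$ and preserve meridians and longitudes otherwise. The result is a space $M'$ together with the link $L'\subset M'$ formed by the cores of the $V_j$. Such neighbourhoods exist for $L=C_{2n}$, and for every choice of them the following holds. (1) For every $i$ let $L'\subset M'$ be the link that results from $0$-surgery on $K_i\cup K_{i+1}\subset C_{2n}$. Then $M'=\mathbb S^3$ and $L'=C_{2n}'$, the link that results from the $ml$-swap $s_i$. Precisely: there is a homeomorphism $F:M'\to\mathbb S^3$ that coincides with $s_i$ on the exterior $X$ and takes the core of $V_j$ to the component $s_i(K_j)$ of $C'_{2n}$ for every $j$ (where $s_i(K_j)$ means $K_j$ if $j\in\{i,i+1\}$). (2) More generally, let $L$ be a non-overlapping nested partner of $C_{2n}$, created by the pairwise non-overlapping $ml$-swaps $s_{i_1},\dots,s_{i_m}$. Then $L$ is the result of $0$-surgery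 on the sublink $\bigcup_k(K_{i_k}\cup K_{i_k+1})\subset C_{2n}$. Precisely: there is a homeomorphism $F$ from the surgered space to $\mathbb S^3$ that takes the core of each $V_j$ to the corresponding component of $L$ and coincides on $X$ with $s_{i_1}\circ\dots\circ s_{i_m}$ followed by a homeomorphism of $\mathbb S^3$ isotopic to the identity. -/

import Mathlib

open scoped ContDiff

noncomputable section

/-! ### The three-sphere, isotopy of links -/

/-- The space `ℂ²` with its Euclidean norm. -/
abbrev C2 : Type := EuclideanSpace ℂ (Fin 2)

/-- The three-sphere: the unit sphere of `ℂ²`, with the orientation as the boundary of the unit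
ball. -/
abbrev S3 : Type := Metric.sphere (0 : C2) 1

/-- `Φ` is the end of an isotopy of `S³` that starts at the identity. -/
def IsotopicToId (Φ : S3 ≃ₜ S3) : Prop :=
  ∃ h : unitInterval → (S3 ≃ₜ S3),
    Continuous (fun p : unitInterval × S3 => h p.1 p.2) ∧ h 0 = Homeomorph.refl S3 ∧ h 1 = Φ

/-- A link is given by the family of its components. Two links with components indexed by `ι` are
isotopic if an ambient isotopy carries each component to the component with the same index. -/
def LinkIsotopic {ι : Type} (K L : ι → Set S3) : Prop :=
  ∃ Φ : S3 ≃ₜ S3, IsotopicToId Φ ∧ ∀ j, Φ '' K j = L j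

/-! ### Framed tubular neighbourhoods and 0-surgery on a sublink -/

/-- The loop `γ` lies in `U` and is null-homologous there: its class in the first homology group
of `U`, that is, in the abelianized fundamental group, is trivial. -/
def NullHomologousIn (U : Set S3) (γ : Circle → S3) : Prop :=
  ∃ (x : U) (p : Path x x), (∀ t : unitInterval, (p t : S3) = γ (Circle.exp (2 * Real.pi * t))) ∧
    Abelianization.of (FundamentalGroup.fromPath (Path.Homotopic.Quotient.mk p)) = 1

/-- A system of tubular neighbourhoods of the components of a link, each parametrized by
`ℝ² × S¹` (with `ℝ² = ℂ`) so that `{0} × S¹` is the component and `{1} × S¹` is a preferred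
longitude. The closed tubes, the images of `D² × S¹`, are disjoint. On the boundary torus of the
`j`-th closed tube, `u ↦ tube j (u, v)` is a meridian and `v ↦ tube j (u, v)` is a preferred
longitude. -/
structure TubeSystem {ι : Type} (K : ι → Set S3) where
  tube : ι → ℂ × Circle → S3
  smooth : ∀ j, ContDiff ℝ ∞ (fun y : ℂ × ℝ => (tube j (y.1, Circle.exp y.2) : C2))
  immersion : ∀ j y, Function.Injective
    (fderiv ℝ (fun y : ℂ × ℝ => (tube j (y.1, Circle.exp y.2) : C2)) y)
  injective : ∀ j, Function.Injective (tube j)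
  core : ∀ j, Set.range (fun v : Circle => tube j (0, v)) = K j
  disjoint : ∀ j k, j ≠ k →
    Disjoint (tube j '' (Metric.closedBall 0 1 ×ˢ Set.univ))
      (tube k '' (Metric.closedBall 0 1 ×ˢ Set.univ))
  preferred : ∀ j, NullHomologousIn (K j)ᶜ (fun v : Circle => tube j (1, v))

/-- The exterior of the link: the complement of the interiors of the closed tubes. -/
def TubeSystem.exterior {ι : Type} {K : ι → Set S3} (T : TubeSystem K) : Set S3 :=
  {x | ∀ j, x ∉ T.tube j '' (Metric.ball 0 1 ×ˢ Set.univ)}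

/-- The closed unit disk `D²`. -/
abbrev Disk : Type := Metric.closedBall (0 : ℂ) 1

/-- The boundary circle of `D²`. -/
def diskBoundary (u : Circle) : Disk := ⟨u, by simp [Circle.norm_coe]⟩

/-- The centre of `D²`. -/
def diskCentre : Disk := ⟨0, by simp⟩

/-- The gluing relation on the disjoint union of the exterior and of solid tori `V j = D² × S¹`.
If `j` is in the sublink `S` (label `0`), the gluing map of `∂ (V j)` swaps meridians and
longitudes; otherwise (label `∞`) it preserves meridians and longitudes. -/
inductive TubeSystem.Glue {ι : Type} {K : ι → Set S3} (T : TubeSystem K) (S : Set ι) :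
    (T.exterior ⊕ (Σ _ : ι, Disk × Circle)) → (T.exterior ⊕ (Σ _ : ι, Disk × Circle)) → Prop
  | swap (j : ι) (hj : j ∈ S) (u v : Circle) (x : T.exterior)
      (hx : (x : S3) = T.tube j ((v : ℂ), u)) :
      TubeSystem.Glue T S (Sum.inr ⟨j, diskBoundary u, v⟩) (Sum.inl x)
  | keep (j : ι) (hj : j ∉ S) (u v : Circle) (x : T.exterior)
      (hx : (x : S3) = T.tube j ((u : ℂ), v)) :
      TubeSystem.Glue T S (Sum.inr ⟨j, diskBoundary u, v⟩) (Sum.inl x)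

/-- The space that results from `0`-surgery on the sublink `S` (and `∞`-surgery on the other
components), with the quotient topology. -/
def TubeSystem.Surgery {ι : Type} {K : ι → Set S3} (T : TubeSystem K) (S : Set ι) : Type :=
  Quot (T.Glue S)

instance {ι : Type} {K : ι → Set S3} (T : TubeSystem K) (S : Set ι) :
    TopologicalSpace (T.Surgery S) :=
  inferInstanceAs (TopologicalSpace (Quot (T.Glue S)))

/-- The inclusion of the exterior in the surgered space. -/
def TubeSystem.ofExterior {ι : Type} {K : ι → Set S3} (T : TubeSystem K) (S : Set ι)
    (x : T.exterior) : T.Surgery S :=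
  Quot.mk _ (Sum.inl x)

/-- The link in the surgered space formed by the cores of the solid tori. -/
def TubeSystem.coreLink {ι : Type} {K : ι → Set S3} (T : TubeSystem K) (S : Set ι) (j : ι) :
    Set (T.Surgery S) :=
  Set.range (fun v : Circle => (Quot.mk _ (Sum.inr ⟨j, diskCentre, v⟩) : T.Surgery S))

/-! ### The minimally twisted chain link -/

/-- A complex function on `S³` whose zero set is the `k`-th component of the chain. Its argument
fibres the complement of that component by open disks. -/
def chainFun (n k : ℕ) (x : S3) : ℂ :=
  ⟨((x : C2) 0 * Complex.exp (-(k * Real.pi / n * Complex.I))).re - Real.cos (3 * Real.pi / (4 * n)),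
    ((x : C2) 1 * Complex.I ^ k).im⟩

/-- The minimally twisted `2n`-chain link. In coordinates `(z, w)` of `ℂ²`, the component `K j` is
the round circle of angular radius `3π/(4n)` about the point `e^{iπj/n}` of the axis `w = 0`, in
the two-sphere `w ∈ ℝ` for even `j` and in the two-sphere `w ∈ iℝ` for odd `j`; the two spheres
meet at right angles along the axis. (Stereographic projection from `(0, 1)` takes the first sphere
to the projection plane and the second one to the unit sphere, so the components with even `j` are
round circles in the projection plane and the others are round circles in vertical planes.)
It bounds the disk `D j` on which `chainFun` is real and nonnegative. -/
def chainLink (n : ℕ) (j : ZMod (2 * n)) : Set S3 := {x | chainFun n j.val x = 0}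

/-- A ray from a point inside an ellipsoid meets the ellipsoid exactly once. -/
theorem existsUnique_pos_root (A B C : ℝ) (hA : 0 < A) (hC : C < 0) :
    ∃! s : ℝ, 0 < s ∧ A * s ^ 2 + B * s + C = 0 := by
  have hD : B ^ 2 < B ^ 2 - 4 * A * C := by nlinarith
  set r := Real.sqrt (B ^ 2 - 4 * A * C) with hr
  have hr2 : r ^ 2 = B ^ 2 - 4 * A * C := Real.sq_sqrt (by nlinarith [sq_nonneg B])
  have hr0 : 0 ≤ r := Real.sqrt_nonneg _
  have hBr : B < r := by
    have h1 : B ^ 2 < r ^ 2 := hr2 ▸ hD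
    exact lt_of_le_of_lt (le_abs_self B) (abs_lt_of_sq_lt_sq h1 hr0)
  have hs0 : 0 < (-B + r) / (2 * A) := by apply div_pos <;> linarith
  refine ⟨(-B + r) / (2 * A), ⟨hs0, ?_⟩, ?_⟩
  · field_simp
    nlinarith
  · rintro t ⟨ht, h⟩
    have h1 : A * ((-B + r) / (2 * A)) ^ 2 + B * ((-B + r) / (2 * A)) + C = 0 := by
      field_simp
      nlinarith
    set s := (-B + r) / (2 * A)
    have h2 : (t - s) * (A * (t * s) - C) = 0 := by linear_combination s * h - t * h1
    rcases mul_eq_zero.1 h2 with h3 | h3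
    · linarith
    · nlinarith [mul_pos hA (mul_pos ht hs0)]

theorem chainFun_angles (n : ℕ) (hn : 2 ≤ n) :
    0 < Real.sin (Real.pi / n) ∧
    2 * Real.cos (3 * Real.pi / (4 * n)) ^ 2 < 1 + Real.cos (Real.pi / n) := by
  have hn' : (2 : ℝ) ≤ n := by exact_mod_cast hn
  have hpi := Real.pi_pos
  have ha : 0 < Real.pi / n := by positivity
  have ha2 : Real.pi / n ≤ Real.pi / 2 := by gcongr
  refine ⟨Real.sin_pos_of_pos_of_lt_pi ha (by linarith), ?_⟩
  have e : 3 * Real.pi / (4 * n) = 3 / 4 * (Real.pi / n) := by field_simp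
  rw [e]
  set a := Real.pi / n
  have h2 := Real.cos_sq (3 / 4 * a)
  have : Real.cos (2 * (3 / 4 * a)) < Real.cos a :=
    Real.cos_lt_cos_of_nonneg_of_le_pi (by linarith) (by linarith) (by linarith)
  linarith

/-- For `(p, q) ≠ 0` and `n ≥ 2` there is exactly one point of `S³` at which the functions of the
`k`-th and the `(k+1)`-st component have the values `s p` and `s q` for some `s > 0`. -/
theorem existsUnique_chainFun (n k : ℕ) (hn : 2 ≤ n) (p q : ℂ) (h : p ≠ 0 ∨ q ≠ 0) :
    ∃! y : S3, ∃ s : ℝ, 0 < s ∧ chainFun n k y = s * p ∧ chainFun n (k + 1) y = s * q := by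
  obtain ⟨hS, hc⟩ := chainFun_angles n hn
  set a := Real.pi / n with ha
  set r := Real.cos (3 * Real.pi / (4 * n)) with hr
  set e : ℂ := Complex.exp (-(k * Real.pi / n * Complex.I)) with he
  have hen : ‖e‖ = 1 := by
    have : e = Complex.exp (((-(k * Real.pi / n) : ℝ) : ℂ) * Complex.I) := by
      rw [he]; push_cast; ring_nf
    rw [this, Complex.norm_exp_ofReal_mul_I]
  have he0 : e ≠ 0 := Complex.exp_ne_zero _
  have hI0 : (Complex.I ^ k : ℂ) ≠ 0 := pow_ne_zero _ Complex.I_ne_zero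
  have hIn : ‖(Complex.I ^ k : ℂ)‖ = 1 := by simp
  have e1 : Complex.exp (-(((k + 1 : ℕ) : ℂ) * Real.pi / n * Complex.I)) =
      e * ((Real.cos a : ℂ) - Real.sin a * Complex.I) := by
    have : -(((k + 1 : ℕ) : ℂ) * Real.pi / n * Complex.I) =
        -(k * Real.pi / n * Complex.I) + ((-a : ℝ) : ℂ) * Complex.I := by
      rw [ha]; push_cast; ring
    rw [this, Complex.exp_add, Complex.exp_mul_I]
    rw [← Complex.ofReal_cos, ← Complex.ofReal_sin, Real.cos_neg, Real.sin_neg]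
    push_cast; ring
  set c := Real.cos a with hcd
  set S := Real.sin a with hSd
  have hcS : S ^ 2 + c ^ 2 = 1 := Real.sin_sq_add_cos_sq a
  -- the conditions on a point in rotated coordinates
  have key : ∀ (y : S3) (s : ℝ),
      (chainFun n k y = s * p ∧ chainFun n (k + 1) y = s * q) ↔
      (((y : C2) 0 * e).re = r + s * p.re ∧ ((y : C2) 0 * e).im * S = r + s * q.re -
        (r + s * p.re) * c ∧ ((y : C2) 1 * Complex.I ^ k).im = s * p.im ∧
        ((y : C2) 1 * Complex.I ^ k).re = s * q.im) := by
    intro y s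
    have f1 : chainFun n k y = ⟨((y : C2) 0 * e).re - r, ((y : C2) 1 * Complex.I ^ k).im⟩ := rfl
    have f2 : chainFun n (k + 1) y = ⟨((y : C2) 0 * e).re * c + ((y : C2) 0 * e).im * S - r,
        ((y : C2) 1 * Complex.I ^ k).re⟩ := by
      unfold chainFun
      rw [e1, ← mul_assoc, pow_succ, ← mul_assoc]
      apply Complex.ext
      · simp [Complex.mul_re, Complex.mul_im, hr]
      · simp [Complex.mul_im]
    rw [f1, f2]
    simp only [Complex.ext_iff, Complex.mul_re, Complex.mul_im, Complex.ofReal_re,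
      Complex.ofReal_im]
    constructor
    · rintro ⟨⟨h1, h2⟩, h3, h4⟩
      refine ⟨by linarith, ?_, by linarith, by linarith⟩
      have : ((y : C2) 0).re * e.re - ((y : C2) 0).im * e.im = r + s * p.re := by linarith
      rw [this] at h3
      linarith
    · rintro ⟨h1, h2, h3, h4⟩
      refine ⟨⟨by linarith, by linarith⟩, ?_, by linarith⟩
      rw [h1]
      linarith
  have hnorm : ∀ y : C2, ‖y‖ ^ 2 = (y 0 * e).re ^ 2 + (y 0 * e).im ^ 2 +
      ((y 1 * Complex.I ^ k).re ^ 2 + (y 1 * Complex.I ^ k).im ^ 2) := by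
    intro y
    have g : ∀ z : ℂ, z.re ^ 2 + z.im ^ 2 = ‖z‖ ^ 2 := fun z => by
      rw [← Complex.normSq_eq_norm_sq, Complex.normSq_apply]; ring
    rw [g, g, norm_mul, norm_mul, hen, hIn, mul_one, mul_one, EuclideanSpace.norm_sq_eq]
    simp
  clear_value e c S r
  -- the quadratic equation for the scale
  set A := S ^ 2 * (p.re ^ 2 + p.im ^ 2 + q.im ^ 2) + (q.re - p.re * c) ^ 2 with hA
  set B := 2 * (S ^ 2 * (r * p.re) + (r - r * c) * (q.re - p.re * c)) with hB
  set D := S ^ 2 * r ^ 2 + (r - r * c) ^ 2 - S ^ 2 with hD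
  have hA0 : 0 < A := by
    have hS2 : 0 < S ^ 2 := by positivity
    by_contra hneg
    have h0 : 0 ≤ S ^ 2 * (p.re ^ 2 + p.im ^ 2 + q.im ^ 2) := by positivity
    have h1 := sq_nonneg (q.re - p.re * c)
    have h2 : S ^ 2 * (p.re ^ 2 + p.im ^ 2 + q.im ^ 2) = 0 := by linarith
    have h3 : (q.re - p.re * c) ^ 2 = 0 := by linarith
    have h4 : p.re ^ 2 + p.im ^ 2 + q.im ^ 2 = 0 := (mul_eq_zero.1 h2).resolve_left hS2.ne'
    have p1 : p.re = 0 := by nlinarith [sq_nonneg p.re, sq_nonneg p.im, sq_nonneg q.im]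
    have p2 : p.im = 0 := by nlinarith [sq_nonneg p.re, sq_nonneg p.im, sq_nonneg q.im]
    have q2 : q.im = 0 := by nlinarith [sq_nonneg p.re, sq_nonneg p.im, sq_nonneg q.im]
    have q1 : q.re = 0 := by
      have := pow_eq_zero_iff (two_ne_zero) |>.1 h3
      rw [p1] at this; linarith
    rcases h with h | h
    · exact h (Complex.ext p1 p2)
    · exact h (Complex.ext q1 q2)
  have hc1 : 0 < 1 - c := by nlinarith [sq_pos_of_pos hS]
  have hD0 : D < 0 := by
    have : D = (1 - c) * (2 * r ^ 2 - (1 + c)) := by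
      rw [hD]; linear_combination (r ^ 2 - 1) * hcS
    rw [this]
    exact mul_neg_of_pos_of_neg hc1 (by linarith)
  clear_value A B D
  obtain ⟨s, ⟨hs, hroot⟩, huniq⟩ := existsUnique_pos_root A B D hA0 hD0
  have hS0 : S ≠ 0 := hS.ne'
  set u : ℂ := ⟨r + s * p.re, (r + s * q.re - (r + s * p.re) * c) / S⟩ with hu
  set o : ℂ := ⟨s * q.im, s * p.im⟩ with ho
  set y : C2 := !₂[u / e, o / Complex.I ^ k] with hy
  have y0 : y 0 * e = u := by simp [hy, he0]
  have y1 : y 1 * Complex.I ^ k = o := by simp [hy, hI0]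
  clear_value y
  have hy1 : ‖y‖ ^ 2 = 1 := by
    rw [hnorm, y0, y1, hu, ho]
    simp only
    generalize hg : (r + s * q.re - (r + s * p.re) * c) / S = g
    have hg' : g * S = r + s * q.re - (r + s * p.re) * c := by rw [← hg]; field_simp
    have h6 : (g * S) ^ 2 = (r + s * q.re - (r + s * p.re) * c) ^ 2 := by rw [hg']
    rw [hA, hB, hD] at hroot
    refine mul_left_cancel₀ (pow_ne_zero 2 hS0) ?_
    linear_combination hroot + h6
  have hyS : y ∈ Metric.sphere (0 : C2) 1 := by
    rw [mem_sphere_zero_iff_norm]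
    exact (pow_eq_one_iff_of_nonneg (norm_nonneg y) two_ne_zero).1 hy1
  refine ⟨⟨y, hyS⟩, ⟨s, hs, (key _ _).2 ?_⟩, ?_⟩
  · simp only [y0, y1, hu, ho]
    refine ⟨trivial, ?_, trivial, trivial⟩
    field_simp
  · rintro x ⟨t, ht, hx⟩
    obtain ⟨h1, h2, h3, h4⟩ := (key _ _).1 hx
    have hx1 : ‖(x : C2)‖ ^ 2 = 1 := by
      rw [mem_sphere_zero_iff_norm.1 x.2]; norm_num
    rw [hnorm, h1, h3, h4] at hx1
    have hts : t = s := by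
      apply huniq
      refine ⟨ht, ?_⟩
      have h5 := congrArg (fun z => z ^ 2) h2
      simp only at h5
      rw [hA, hB, hD]
      linear_combination S ^ 2 * hx1 - h5
    have hx0 : (x : C2) 0 * e = y 0 * e := by
      rw [y0, hu]
      apply Complex.ext
      · rw [h1, hts]
      · simp only
        rw [eq_div_iff hS0, h2, hts]
    have hx2 : (x : C2) 1 * Complex.I ^ k = y 1 * Complex.I ^ k := by
      rw [y1, ho]
      apply Complex.ext
      · rw [h4, hts]
      · rw [h3, hts]
    apply Subtype.ext
    ext j
    fin_cases j
    · exact mul_right_cancel₀ he0 hx0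
    · exact mul_right_cancel₀ hI0 hx2

open Classical in
/-- The point of `S³` at which `(chainFun n k, chainFun n (k + 1))` is a positive multiple of
`(p, q)`. (The value `x` is used only if there is no such point.) In other words, the pair of
functions, followed by radial projection, is an orientation-preserving homeomorphism of `S³` that
takes the `k`-th and the `(k+1)`-st component to the standard Hopf link in the unit sphere of `ℂ²`,
and this is the point with image `(p, q) / |(p, q)|`. -/
def hopfPoint (n k : ℕ) (x : S3) (p q : ℂ) : S3 :=
  if h : ∃ y : S3, ∃ s : ℝ, 0 < s ∧ chainFun n k y = s * p ∧ chainFun n (k + 1) y = s * q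
  then h.choose else x

/-! ### Dehn twists along annuli, and `ml`-swaps -/

/-- The rotation `e^{i (2 θ + π)}` at a point with argument `θ ∈ [-π/2, π/2]`, and `1` at the points
with nonpositive real part: a full turn, from angle `0` to angle `2π`, as the argument runs from
`-π/2` to `π/2`. -/
def fullTurn (p : ℂ) : ℂ := if 0 < p.re then -(p / ‖p‖) ^ 2 else 1

/-- The right-handed Dehn twist along the annulus `A k = D k \ K (k + 1)`. With
`p = chainFun n k` and `q = chainFun n (k + 1)` the annulus is `{p > 0, q ≠ 0}`, its product
neighbourhood is `{Re p > 0, q ≠ 0}` with the interval coordinate `arg p`, and the rotation of the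
annulus is the rotation of `q`. The twist is a homeomorphism of the complement of the two circles
`p = 0` and `q = 0`, the identity outside the product neighbourhood; on the two circles it is put
equal to the identity. -/
def rightTwist (n k : ℕ) (x : S3) : S3 :=
  hopfPoint n k x (chainFun n k x) (fullTurn (chainFun n k x) * chainFun n (k + 1) x)

/-- The left-handed Dehn twist along the annulus `A (k + 1) = D (k + 1) \ K k`, in the same
coordinates: the roles of `p` and `q` are exchanged and the rotation is inverted. -/
def leftTwist (n k : ℕ) (x : S3) : S3 :=
  hopfPoint n k x (star (fullTurn (chainFun n (k + 1) x)) * chainFun n k x) (chainFun n (k + 1) x)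

/-- The `i`-th `ml`-swap: a right-handed twist along `A i`, then a left-handed twist along
`A (i + 1)`, then a right-handed twist along `A i`. On `K i` and `K (i + 1)` it is the identity. -/
def mlSwap (n : ℕ) (i : ZMod (2 * n)) (x : S3) : S3 :=
  rightTwist n i.val (leftTwist n i.val (rightTwist n i.val x))

/-- The `ml`-swaps with indices `i` and `j` do not overlap: `|i - j| ≥ 4` modulo `2n`. -/
def NonOverlapping (n : ℕ) (i j : ZMod (2 * n)) : Prop := 4 ≤ (i - j).valMinAbs.natAbs

/-- The composition of the `ml`-swaps in a list of indices. -/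
def mlSwaps (n : ℕ) (l : List (ZMod (2 * n))) : S3 → S3 :=
  l.foldr (fun i f => mlSwap n i ∘ f) id

/-- `L` is a non-overlapping nested partner of the chain link, created by the `ml`-swaps with
indices in the list `l`: these do not overlap, and `L` is isotopic to the link that they produce. -/
def IsNestedPartner (n : ℕ) (l : List (ZMod (2 * n))) (L : ZMod (2 * n) → Set S3) : Prop :=
  l.Pairwise (NonOverlapping n) ∧ LinkIsotopic (fun j => mlSwaps n l '' chainLink n j) L

/-- The sublink involved in a list of `ml`-swaps: the union of the Hopf links `K i ∪ K (i + 1)`. -/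
def hopfSublink (n : ℕ) (l : List (ZMod (2 * n))) : Set (ZMod (2 * n)) :=
  {j | ∃ i ∈ l, j = i ∨ j = i + 1}

end

noncomputable section

/-! The complement of the Hopf link `K i ∪ K (i + 1)` is an open interval times a torus; the torus
coordinates are the arguments of the two functions of a `HopfFrame`. In these coordinates each Dehn
twist is a shear of the torus, and an `ml`-swap acts through the single torus homeomorphism
`torusSwap 1` (`mlSwap_eq`). The shears turn only over a half circle, but `turn` deforms them to
linear shears, and the product of the three linear shears is the quarter turn `(α, β) ↦ (β⁻¹, α)`
(`torusSwap_zero`). So, up to isotopy, the swap exchanges the meridians and longitudes of both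
components. The gluing maps of `0`-surgery do the same, and therefore the swap extends over the new
solid tori.

This reduces the theorem to the predicate `TubeSystem.Realizes`: a bijection of `S³`, continuous off
the sublink, that extends over each new solid torus with image `f '' T.closedTube j`. Such
extensions fit together to a continuous bijection from the compact surgered space to the Hausdorff
space `S³`, which is a homeomorphism (`Realizes.exists_homeomorph`).

The work lies in the extension, because the tubes are arbitrary and equality with the swap is
required on the whole exterior, not just up to isotopy. In polar coordinates a tube blows up along
its core: its angles have a limit at radius zero, which is linear on the normal fibres
(`TubeSystem.exists_blowup`). A preferred longitude is null-homologous off the component, so the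
limiting fibre direction has a continuous argument (`NullHomologousIn.exists_arg`); hence the
angular map is isotopic to a product map (`exists_linear_isotopy`). `HopfFrame.exists_extension`
spends both isotopies along the radius of the solid torus. At radius one the prescribed boundary
values are untouched, and at radius zero the surviving coordinate depends only on the core
parameter, so the map descends to `D² × S¹`.

For several swaps, each is supported over a short arc of the axis. Non-overlapping swaps have
disjoint supports, so they commute and fix one another's components, and `Realizes.comp` with
induction on the list gives the second part. Tubes exist because a conformal map of `S³` carries a
great circle to each component (`boost`), and thin standard tubes around the great circle go to the
required ones. -/

theorem isOpenQuotientMap_circleExp : IsOpenQuotientMap Circle.exp :=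
  ⟨Circle.exp_surjective, Circle.exp.continuous, isLocalHomeomorph_circleExp.isOpenMap⟩

/-- An open quotient map stays a quotient map after a product with the identity. This transfers
continuity from the line, where the tubes are known to be smooth, to the circle. -/
theorem continuous_comp_circleExp_iff {X Z : Type*} [TopologicalSpace X] [TopologicalSpace Z]
    {f : X × Circle → Z} :
    Continuous f ↔ Continuous fun y : X × ℝ => f (y.1, Circle.exp y.2) :=
  ((IsOpenQuotientMap.id (X := X)).prodMap isOpenQuotientMap_circleExp).isQuotientMap.continuous_iff

/-! ### Tubes are open; compactness of the surgered space -/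

namespace TubeSystem

variable {ι : Type} {K : ι → Set S3} (T : TubeSystem K)

theorem continuous_tube (j : ι) : Continuous (T.tube j) := by
  rw [continuous_comp_circleExp_iff, continuous_induced_rng]
  exact (T.smooth j).continuous

/-- Differentiating `‖φ‖ ^ 2 = 1` shows that the derivative is tangent to the sphere. -/
theorem inner_fderiv_tube (j : ι) (y ξ : ℂ × ℝ) :
    inner ℝ (T.tube j (y.1, Circle.exp y.2) : C2)
      (fderiv ℝ (fun y : ℂ × ℝ => (T.tube j (y.1, Circle.exp y.2) : C2)) y ξ) = 0 := by
  set φ := fun y : ℂ × ℝ => (T.tube j (y.1, Circle.exp y.2) : C2)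
  have hd : HasFDerivAt φ (fderiv ℝ φ y) y :=
    ((T.smooth j).differentiable (by simp)).differentiableAt.hasFDerivAt
  have h1 := hd.norm_sq
  have h2 : (fun y => ‖φ y‖ ^ 2) = fun _ => (1 : ℝ) := by
    funext y
    rw [mem_sphere_zero_iff_norm.1 (T.tube j (y.1, Circle.exp y.2)).2, one_pow]
  rw [h2] at h1
  have h3 := congrArg (fun L => L ξ) (h1.unique (hasFDerivAt_const _ _))
  simpa using h3

/-- The sphere is replaced by `ℂ²` through the cone map `(y, s) ↦ s • φ y`. Its derivative at `s =
1` is injective, since the radial direction is orthogonal to the tangential ones; both sides have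
dimension four, so it is surjective and the cone map is open there. On the sphere the norm forces `s
= 1`. -/
theorem isOpen_image_tube (j : ι) (U : Set (ℂ × Circle)) (hU : IsOpen U) : IsOpen (T.tube j '' U) := by
  rw [isOpen_iff_mem_nhds]
  rintro _ ⟨⟨u, v⟩, hy, rfl⟩
  obtain ⟨t, rfl⟩ := Circle.exp_surjective v
  set φ := fun y : ℂ × ℝ => (T.tube j (y.1, Circle.exp y.2) : C2) with hφ
  set E : (ℂ × ℝ) × ℝ → C2 := fun y => y.2 • φ y.1 with hE
  set y₀ : (ℂ × ℝ) × ℝ := ((u, t), 1) with hy₀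
  have hsm : ContDiff ℝ ∞ E := contDiff_snd.smul ((T.smooth j).comp contDiff_fst)
  have hst : HasStrictFDerivAt E (fderiv ℝ E y₀) y₀ :=
    hsm.contDiffAt.hasStrictFDerivAt (by simp)
  have hφd : HasFDerivAt φ (fderiv ℝ φ y₀.1) y₀.1 :=
    ((T.smooth j).differentiable (by simp)).differentiableAt.hasFDerivAt
  have hd : HasFDerivAt E _ y₀ :=
    (hasFDerivAt_snd (𝕜 := ℝ) (p := y₀)).smul
      (hφd.comp y₀ (hasFDerivAt_fst (𝕜 := ℝ) (p := y₀)))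
  have hn : ‖φ y₀.1‖ = 1 := mem_sphere_zero_iff_norm.1 (T.tube j (u, Circle.exp t)).2
  have hinj : Function.Injective (fderiv ℝ E y₀) := by
    rw [injective_iff_map_eq_zero]
    rintro ⟨ξ, lam⟩ h
    rw [hd.fderiv] at h
    have h' : fderiv ℝ φ y₀.1 ξ + lam • φ y₀.1 = 0 := by
      simpa [hy₀] using h
    have h2 := congrArg (fun x => inner ℝ (φ y₀.1) x) h'
    simp only [inner_add_right, inner_smul_right, real_inner_self_eq_norm_sq, hn,
      inner_zero_right] at h2
    rw [show inner ℝ (φ y₀.1) (fderiv ℝ φ y₀.1 ξ) = 0 from T.inner_fderiv_tube j y₀.1 ξ] at h2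
    have hl : lam = 0 := by linarith
    rw [hl, zero_smul, add_zero] at h'
    have := T.immersion j y₀.1 (h'.trans (map_zero _).symm)
    simp [hl, this]
  have hsurj : (fderiv ℝ E y₀).range = ⊤ := by
    apply LinearMap.range_eq_top.2
    refine (LinearMap.injective_iff_surjective_of_finrank_eq_finrank ?_).1 hinj
    have : Module.finrank ℝ C2 = 4 := by
      rw [← Module.finrank_mul_finrank ℝ ℂ C2]
      simp
    rw [this]
    simp
  have hmap := hst.map_nhds_eq_of_surj hsurj
  have hU' : {y : (ℂ × ℝ) × ℝ | (y.1.1, Circle.exp y.1.2) ∈ U ∧ 0 < y.2} ∈ nhds y₀ := by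
    refine IsOpen.mem_nhds (IsOpen.inter ?_ ?_) ⟨hy, by simp [hy₀]⟩
    · exact hU.preimage (by fun_prop)
    · exact isOpen_lt continuous_const continuous_snd
  have himg := Filter.image_mem_map (m := E) hU'
  rw [hmap] at himg
  have h0 : E y₀ = (T.tube j (u, Circle.exp t) : C2) := by simp [hE, hφ, hy₀]
  rw [h0] at himg
  filter_upwards [continuous_subtype_val.continuousAt.preimage_mem_nhds himg]
  rintro x ⟨⟨⟨u', t'⟩, s⟩, ⟨h1, h2⟩, h3⟩
  refine ⟨(u', Circle.exp t'), h1, ?_⟩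
  have h4 : s = 1 := by
    have := congrArg norm h3
    rw [mem_sphere_zero_iff_norm.1 x.2] at this
    simp only [hE, hφ, norm_smul] at this
    rw [mem_sphere_zero_iff_norm.1 (T.tube j (u', Circle.exp t')).2] at this
    simpa [abs_of_pos h2] using this
  apply Subtype.ext
  simpa [hE, h4] using h3

theorem isClosed_exterior : IsClosed T.exterior := by
  have : T.exterior = ⋂ j, (T.tube j '' (Metric.ball 0 1 ×ˢ Set.univ))ᶜ := by
    ext x; simp [exterior]
  rw [this]
  exact isClosed_iInter fun j =>
    (T.isOpen_image_tube j _ (Metric.isOpen_ball.prod isOpen_univ)).isClosed_compl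

instance : CompactSpace S3 := isCompact_iff_compactSpace.1 (isCompact_sphere _ _)

instance compactSpace_exterior : CompactSpace T.exterior :=
  isCompact_iff_compactSpace.1 T.isClosed_exterior.isCompact

instance : CompactSpace Disk :=
  isCompact_iff_compactSpace.1 (isCompact_closedBall _ _)

instance [Finite ι] (S : Set ι) : CompactSpace (T.Surgery S) :=
  inferInstanceAs (CompactSpace (Quot (T.Glue S)))

/-! ### From a map of the sphere to a homeomorphism of the surgered space -/

/-- The closed tube. -/
def closedTube (j : ι) : Set S3 := T.tube j '' (Metric.closedBall 0 1 ×ˢ Set.univ)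

theorem core_mem_openTube {j : ι} {x : S3} (hx : x ∈ K j) :
    x ∈ T.tube j '' (Metric.ball 0 1 ×ˢ Set.univ) := by
  rw [← T.core j] at hx
  obtain ⟨v, rfl⟩ := hx
  exact ⟨(0, v), by simp, rfl⟩

theorem core_subset_closedTube (j : ι) : K j ⊆ T.closedTube j := fun _ hx =>
  Set.image_mono (Set.prod_mono Metric.ball_subset_closedBall subset_rfl)
    (T.core_mem_openTube hx)

theorem disjoint_closedTube {j k : ι} (h : j ≠ k) : Disjoint (T.closedTube j) (T.closedTube k) :=
  T.disjoint j k h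

/-- `f` is a bijection of `S³` that is continuous off the components of the sublink `S`, preserves
these components, and extends over the solid tori that are glued in by `0`-surgery on `S`, with
the cores of these going to the components. -/
structure Realizes (S : Set ι) (f : S3 → S3) : Prop where
  bijective : Function.Bijective f
  continuousOn : ContinuousOn f (⋃ j ∈ S, K j)ᶜ
  image_core : ∀ j ∈ S, f '' K j = K j
  extend : ∀ j ∈ S, ∃ G : Disk × Circle → S3, Continuous G ∧ Function.Injective G ∧
    (∀ u v, G (diskBoundary u, v) = f (T.tube j (v, u))) ∧
    Set.range G = f '' T.closedTube j ∧ Set.range (fun v => G (diskCentre, v)) = K j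

variable {T} {S : Set ι} {f : S3 → S3}

/-- For `j ∉ S` the solid torus is glued back as before and `f` composed with the tube serves; it is
continuous because the closed tube misses the components in `S`, where `f` may be discontinuous. -/
theorem Realizes.exists_family (h : T.Realizes S f) :
    ∃ G : ι → Disk × Circle → S3, ∀ j, Continuous (G j) ∧ Function.Injective (G j) ∧
      (j ∈ S → ∀ u v, G j (diskBoundary u, v) = f (T.tube j (v, u))) ∧
      (j ∉ S → ∀ u v, G j (diskBoundary u, v) = f (T.tube j (u, v))) ∧
      Set.range (G j) = f '' T.closedTube j ∧
      Set.range (fun v => G j (diskCentre, v)) = f '' K j := by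
  rw [← Classical.skolem (p := fun j (G : Disk × Circle → S3) => Continuous G ∧
      Function.Injective G ∧ (j ∈ S → ∀ u v, G (diskBoundary u, v) = f (T.tube j (v, u))) ∧
      (j ∉ S → ∀ u v, G (diskBoundary u, v) = f (T.tube j (u, v))) ∧
      Set.range G = f '' T.closedTube j ∧ Set.range (fun v => G (diskCentre, v)) = f '' K j)]
  intro j
  by_cases hj : j ∈ S
  · obtain ⟨G, h1, h2, h3, h4, h5⟩ := h.extend j hj
    exact ⟨G, h1, h2, fun _ => h3, fun h => absurd hj h, h4, by rw [h5, h.image_core j hj]⟩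
  · have hmem : ∀ y : Disk × Circle, T.tube j (y.1, y.2) ∈ T.closedTube j := fun y =>
      ⟨(y.1, y.2), ⟨y.1.2, trivial⟩, rfl⟩
    refine ⟨fun y => f (T.tube j (y.1, y.2)), ?_, ?_, fun h => absurd h hj, fun _ u v => rfl,
      ?_, ?_⟩
    · refine h.continuousOn.comp_continuous ((T.continuous_tube j).comp (by fun_prop)) fun y => ?_
      simp only [Set.mem_compl_iff, Set.mem_iUnion, not_exists]
      intro k hk hy
      have hjk : j ≠ k := fun e => hj (e ▸ hk)
      exact Set.disjoint_left.1 (T.disjoint_closedTube hjk) (hmem y)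
        (T.core_subset_closedTube k hy)
    · intro y y' hyy
      have := T.injective j (h.bijective.1 hyy)
      simp only [Prod.mk.injEq] at this
      exact Prod.ext (Subtype.ext this.1) this.2
    · ext x
      constructor
      · rintro ⟨y, rfl⟩
        exact ⟨_, hmem y, rfl⟩
      · rintro ⟨_, ⟨⟨u, v⟩, hy, rfl⟩, rfl⟩
        exact ⟨(⟨u, hy.1⟩, v), rfl⟩
    · rw [← T.core j, ← Set.range_comp]
      rfl

/-- The images of the solid tori are the `f`-images of disjoint closed tubes, and these meet the
image of the exterior only along boundary tori. The identifications made by the combined map are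
thus exactly those of the gluing. -/
theorem Realizes.exists_homeomorph [Finite ι] (h : T.Realizes S f) :
    ∃ F : T.Surgery S ≃ₜ S3, (∀ x : T.exterior, F (T.ofExterior S x) = f x) ∧
      ∀ j, F '' T.coreLink S j = f '' K j := by
  obtain ⟨G, hG⟩ := h.exists_family
  let F₀ : T.exterior ⊕ (Σ _ : ι, Disk × Circle) → S3 :=
    Sum.elim (fun x => f x) (fun y => G y.1 y.2)
  have hglue : ∀ a b, T.Glue S a b → F₀ a = F₀ b := by
    rintro _ _ (⟨j, hj, u, v, x, hx⟩ | ⟨j, hj, u, v, x, hx⟩)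
    · simp only [F₀, Sum.elim_inr, Sum.elim_inl, hx]
      exact (hG j).2.2.1 hj u v
    · simp only [F₀, Sum.elim_inr, Sum.elim_inl, hx]
      exact (hG j).2.2.2.1 hj u v
  let F₁ : T.Surgery S → S3 := Quot.lift F₀ hglue
  have hcont : Continuous F₁ := by
    refine continuous_quot_lift hglue (Continuous.sumElim ?_ ?_)
    · refine h.continuousOn.comp_continuous continuous_subtype_val fun x => ?_
      simp only [Set.mem_compl_iff, Set.mem_iUnion, not_exists]
      exact fun k _ hx => x.2 k (T.core_mem_openTube hx)
    · exact continuous_sigma fun j => (hG j).1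
  -- A point of the exterior that lies in a closed tube has radius one. There `G j` is prescribed,
  -- and its injectivity identifies `y` with the glued boundary point.
  have hbd : ∀ (x : T.exterior) j y, (f x = G j y) →
      T.Glue S (Sum.inr ⟨j, y⟩) (Sum.inl x) := by
    intro x j y hxy
    have hx : f x ∈ f '' T.closedTube j := by
      rw [← (hG j).2.2.2.2.1, hxy]
      exact Set.mem_range_self y
    rw [h.bijective.1.mem_set_image] at hx
    obtain ⟨⟨a, b⟩, ⟨ha, -⟩, hab⟩ := hx
    have ha1 : ‖a‖ = 1 := by
      refine le_antisymm (mem_closedBall_zero_iff.1 ha) (not_lt.1 fun hlt => ?_)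
      exact x.2 j ⟨(a, b), ⟨mem_ball_zero_iff.2 hlt, trivial⟩, hab⟩
    obtain ⟨c, rfl⟩ : ∃ c : Circle, a = c := ⟨⟨a, mem_sphere_zero_iff_norm.2 ha1⟩, rfl⟩
    by_cases hj : j ∈ S
    · have hy : y = (diskBoundary b, c) := by
        apply (hG j).2.1
        rw [← hxy, (hG j).2.2.1 hj, hab]
      rw [hy]
      exact .swap j hj b c x hab.symm
    · have hy : y = (diskBoundary c, b) := by
        apply (hG j).2.1
        rw [← hxy, (hG j).2.2.2.1 hj, hab]
      rw [hy]
      exact .keep j hj c b x hab.symm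
  have hinj : Function.Injective F₁ := by
    rintro ⟨a⟩ ⟨b⟩ hab
    replace hab : F₀ a = F₀ b := hab
    rcases a with x | ⟨j, y⟩ <;> rcases b with x' | ⟨j', y'⟩
    · rw [Subtype.ext (h.bijective.1 hab)]
    · exact (Quot.sound (hbd x j' y' hab)).symm
    · exact Quot.sound (hbd x' j y hab.symm)
    · replace hab : G j y = G j' y' := hab
      by_cases hj : j = j'
      · subst hj
        rw [(hG j).2.1 hab]
      · exfalso
        have h1 : G j y ∈ f '' T.closedTube j := by
          rw [← (hG j).2.2.2.2.1]
          exact Set.mem_range_self y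
        have h2 : G j y ∈ f '' T.closedTube j' := by
          rw [hab, ← (hG j').2.2.2.2.1]
          exact Set.mem_range_self y'
        obtain ⟨p, hp, hp'⟩ := h1
        rw [← hp', h.bijective.1.mem_set_image] at h2
        exact Set.disjoint_left.1 (T.disjoint_closedTube hj) hp h2
  have hsurj : Function.Surjective F₁ := by
    intro z
    obtain ⟨x, rfl⟩ := h.bijective.2 z
    by_cases hx : x ∈ T.exterior
    · exact ⟨Quot.mk _ (Sum.inl ⟨x, hx⟩), rfl⟩
    · simp only [exterior, Set.mem_ofPred_eq, not_forall, not_not] at hx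
      obtain ⟨j, hj⟩ := hx
      have : f x ∈ Set.range (G j) := by
        rw [(hG j).2.2.2.2.1]
        exact ⟨x, Set.image_mono (Set.prod_mono Metric.ball_subset_closedBall subset_rfl) hj, rfl⟩
      obtain ⟨y, hy⟩ := this
      exact ⟨Quot.mk _ (Sum.inr ⟨j, y⟩), hy⟩
  let F : T.Surgery S ≃ₜ S3 :=
    (isHomeomorph_iff_continuous_bijective.2 ⟨hcont, hinj, hsurj⟩).homeomorph F₁
  refine ⟨F, fun x => rfl, fun j => ?_⟩
  rw [← (hG j).2.2.2.2.2]
  exact (Set.range_comp F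
    (fun v : Circle => (Quot.mk _ (Sum.inr ⟨j, diskCentre, v⟩) : T.Surgery S))).symm

/-- Two commuting maps that realize surgeries on disjoint sublinks and preserve the components of
the other sublink compose to a map that realizes the surgery on the union. -/
theorem Realizes.comp {S' : Set ι} {g : S3 → S3} (hf : T.Realizes S f) (hg : T.Realizes S' g)
    (hdisj : Disjoint S S') (hcomm : ∀ x, f (g x) = g (f x))
    (hfg : ∀ j ∈ S', f '' K j = K j) (hgf : ∀ j ∈ S, g '' K j = K j) :
    T.Realizes (S ∪ S') (f ∘ g) := by
  -- The extension of `a` is followed by `b`. Its image `a '' T.closedTube j` misses the components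
  -- in `B`, because `a` preserves them, so `b` is continuous on it.
  have main : ∀ {A B : Set ι} {a b : S3 → S3}, T.Realizes A a → T.Realizes B b → Disjoint A B →
      (∀ j ∈ B, a '' K j = K j) → ∀ j ∈ A, ∃ G : Disk × Circle → S3, Continuous G ∧
        Function.Injective G ∧ (∀ u v, G (diskBoundary u, v) = b (a (T.tube j (v, u)))) ∧
        Set.range G = b '' (a '' T.closedTube j) ∧
        Set.range (fun v => G (diskCentre, v)) = b '' K j := by
    intro A B a b ha hb hAB hfix j hj
    obtain ⟨G, h1, h2, h3, h4, h5⟩ := ha.extend j hj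
    refine ⟨b ∘ G, ?_, hb.bijective.1.comp h2, fun u v => congrArg b (h3 u v), ?_, ?_⟩
    · refine hb.continuousOn.comp_continuous h1 fun y => ?_
      simp only [Set.mem_compl_iff, Set.mem_iUnion, not_exists]
      intro k hk hy
      have hjk : j ≠ k := fun e => Set.disjoint_left.1 hAB hj (e ▸ hk)
      have h6 : G y ∈ a '' T.closedTube j := h4 ▸ Set.mem_range_self y
      obtain ⟨p, hp, hp'⟩ := h6
      rw [← hfix k hk, ← hp', ha.bijective.1.mem_set_image] at hy
      exact Set.disjoint_left.1 (T.disjoint_closedTube hjk) hp (T.core_subset_closedTube k hy)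
    · rw [Set.range_comp, h4]
    · rw [← h5, ← Set.range_comp]
      rfl
  have hfix : ∀ j ∈ S ∪ S', (f ∘ g) '' K j = K j := by
    rintro j (hj | hj)
    · rw [Set.image_comp, hgf j hj, hf.image_core j hj]
    · rw [Set.image_comp, hg.image_core j hj, hfg j hj]
  refine ⟨hf.bijective.comp hg.bijective, ?_, hfix, ?_⟩
  · refine hf.continuousOn.comp (hg.continuousOn.mono ?_) ?_
    · exact Set.compl_subset_compl.2 (Set.biUnion_subset_biUnion_left Set.subset_union_right)
    · intro x hx
      simp only [Set.mem_compl_iff, Set.mem_iUnion, not_exists] at hx ⊢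
      intro j hj hgx
      rw [← hgf j hj, hg.bijective.1.mem_set_image] at hgx
      exact hx j (Or.inl hj) hgx
  -- The map that is extended must be applied first: on `S` this requires the order `g ∘ f`, on `S'`
  -- the order `f ∘ g`.
  · have hcomm' : f ∘ g = g ∘ f := funext hcomm
    rintro j (hj | hj)
    · obtain ⟨G, h1, h2, h3, h4, h5⟩ := main hf hg hdisj hfg j hj
      exact ⟨G, h1, h2, fun u v => (h3 u v).trans (hcomm _).symm,
        by rw [h4, hcomm', Set.image_comp], by rw [h5, hgf j hj]⟩
    · obtain ⟨G, h1, h2, h3, h4, h5⟩ := main hg hf hdisj.symm hgf j hj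
      exact ⟨G, h1, h2, h3, by rw [h4, Set.image_comp], by rw [h5, hfg j hj]⟩

end TubeSystem

/-! ### Continuous arguments along loops -/

/-- The unit interval covers the circle, with its end points identified. -/
theorem isQuotientMap_loop :
    Topology.IsQuotientMap fun t : unitInterval => Circle.exp (2 * Real.pi * t) := by
  refine Topology.IsQuotientMap.of_surjective_continuous ?_ (by fun_prop)
  intro z
  obtain ⟨s, rfl⟩ := Circle.exp_surjective z
  refine ⟨⟨Int.fract (s / (2 * Real.pi)), Int.fract_nonneg _, (Int.fract_lt_one _).le⟩, ?_⟩
  rw [Circle.exp_eq_exp]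
  refine ⟨-⌊s / (2 * Real.pi)⌋, ?_⟩
  have := Real.pi_pos
  have h := Int.self_sub_floor (s / (2 * Real.pi))
  simp only [← h]
  push_cast
  field_simp
  ring

/-- A loop in the circle whose lift to the line is closed has a continuous argument. -/
theorem exists_arg_of_closed_lift {f : Circle → Circle} {L : unitInterval → ℝ} (hL : Continuous L)
    (h : ∀ t : unitInterval, Circle.exp (L t) = f (Circle.exp (2 * Real.pi * t)))
    (h01 : L 0 = L 1) : ∃ σ : C(Circle, ℝ), ∀ v, Circle.exp (σ v) = f v := by
  have hfac : ∀ s t : unitInterval,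
      Circle.exp (2 * Real.pi * s) = Circle.exp (2 * Real.pi * t) → L s = L t := by
    have key : ∀ s t : unitInterval, s ≤ t →
        Circle.exp (2 * Real.pi * s) = Circle.exp (2 * Real.pi * t) → L s = L t := by
      intro s t hst he
      have hst' : (s : ℝ) ≤ t := hst
      rw [Circle.exp_eq_exp] at he
      obtain ⟨m, hm⟩ := he
      have h2 : (s : ℝ) = t + m := by
        have := Real.pi_pos
        have : 2 * Real.pi * (s : ℝ) = 2 * Real.pi * (t + m) := by rw [hm]; ring
        exact mul_left_cancel₀ (by positivity) this
      have h3 : (m : ℝ) ≤ 0 := by linarith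
      have h4 : (-1 : ℝ) ≤ m := by linarith [s.2.1, t.2.2]
      have h3' : m ≤ 0 := by exact_mod_cast h3
      have h4' : -1 ≤ m := by exact_mod_cast h4
      -- The value `-1` occurs only for the two end points, where the hypothesis `h01` applies.
      obtain rfl | rfl : m = 0 ∨ m = -1 := by omega
      · rw [show s = t from Subtype.ext (by simpa using h2)]
      · push_cast at h2
        have hs : s = 0 := Subtype.ext (by
          change (s : ℝ) = 0; linarith [t.2.2, s.2.1])
        have ht : t = 1 := Subtype.ext (by
          change (t : ℝ) = 1; linarith [t.2.2, s.2.1])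
        rw [hs, ht, h01]
    intro s t he
    rcases le_total s t with hst | hst
    · exact key s t hst he
    · exact (key t s hst he.symm).symm
  have hσ : ∀ t, L (Function.surjInv isQuotientMap_loop.surjective
      (Circle.exp (2 * Real.pi * (t : unitInterval)))) = L t := fun t =>
    hfac _ _ (Function.surjInv_eq isQuotientMap_loop.surjective _)
  refine ⟨⟨fun v => L (Function.surjInv isQuotientMap_loop.surjective v), ?_⟩, fun v => ?_⟩
  · rw [isQuotientMap_loop.continuous_iff]
    exact hL.congr fun t => (hσ t).symm
  · obtain ⟨t, rfl⟩ := isQuotientMap_loop.surjective v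
    exact (congrArg Circle.exp (hσ t)).trans (h t)

/-- A circle-valued function has a continuous argument along a null-homologous loop. -/
theorem NullHomologousIn.exists_arg {U : Set S3} {γ : Circle → S3} (h : NullHomologousIn U γ)
    (f : C(U, Circle)) (hγ : ∀ v, γ v ∈ U) :
    ∃ σ : C(Circle, ℝ), ∀ v, Circle.exp (σ v) = f ⟨γ v, hγ v⟩ := by
  obtain ⟨x, p, hp, hab⟩ := h
  obtain ⟨e, he⟩ := Circle.exp_surjective (f x)
  set e' : Circle.exp ⁻¹' {f x} := ⟨e, he⟩ with he'
  have hcov := Circle.isAddQuotientCoveringMap_exp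
  -- The monodromy of the covering `Circle.exp` pulled back by `f`. Its values lie in a commutative
  -- group, so it kills every class that is trivial in the abelianization; trivial monodromy means
  -- that the lift of the loop closes up.
  let W : FundamentalGroup U x →* (Multiplicative (AddSubgroup.zmultiples (2 * Real.pi)))ᵐᵒᵖ :=
    (hcov.fundamentalGroupToMulOpposite e').comp (FundamentalGroup.map f x)
  have hW : W (FundamentalGroup.fromPath (Path.Homotopic.Quotient.mk p)) = 1 := by
    have := congrArg (Abelianization.lift W) hab
    rwa [Abelianization.lift_apply_of, map_one] at this
  have hmono := hcov.fundamentalGroupToMulOpposite_eq_one_iff.1 hW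
  let L := hcov.isCoveringMap.liftPath (p.map f.continuous) e (by simp [he])
  have hL1 : L 1 = e := congrArg Subtype.val hmono
  have hL0 : L 0 = e := hcov.isCoveringMap.liftPath_zero ..
  refine exists_arg_of_closed_lift (L := L) (f := fun v => f ⟨γ v, hγ v⟩) L.continuous
    (fun t => ?_) (by rw [hL0, hL1])
  have := congrFun (hcov.isCoveringMap.liftPath_lifts (p.map f.continuous) e (by simp [he])) t
  refine this.trans ?_
  simp only [ContinuousMap.coe_coe, Path.map_coe, Function.comp_apply]
  exact congrArg f (Subtype.ext (hp t))

/-- The existence of a continuous argument is invariant under homotopies. -/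
theorem exists_arg_of_homotopy (H : C(unitInterval × Circle, Circle)) (σ : C(Circle, ℝ))
    (h : ∀ v, Circle.exp (σ v) = H (0, v)) :
    ∃ σ' : C(Circle, ℝ), ∀ v, Circle.exp (σ' v) = H (1, v) := by
  have hcov := Circle.isCoveringMap_exp
  let L := hcov.liftHomotopy H σ fun v => (h v).symm
  refine ⟨L.comp ((ContinuousMap.const _ 1).prodMk (ContinuousMap.id _)), fun v => ?_⟩
  exact congrFun (hcov.liftHomotopy_lifts H σ fun v => (h v).symm) (1, v)

/-- The direction of a complex number, with value `1` at `0`. -/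
def dir (z : ℂ) : Circle := if hz : z = 0 then 1 else ⟨z / ‖z‖, by simp [Submonoid.unitSphere, hz]⟩

theorem coe_dir {z : ℂ} (hz : z ≠ 0) : (dir z : ℂ) = z / ‖z‖ := by simp [dir, hz]

theorem norm_mul_dir (z : ℂ) : (‖z‖ : ℂ) * dir z = z := by
  rcases eq_or_ne z 0 with rfl | hz
  · simp
  · rw [coe_dir hz]
    have : (‖z‖ : ℂ) ≠ 0 := by exact_mod_cast (norm_ne_zero_iff.2 hz)
    field_simp

theorem dir_mul {s : ℝ} (hs : 0 < s) (v : Circle) : dir (s * v) = v := by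
  have h : (s : ℂ) ≠ 0 := by exact_mod_cast hs.ne'
  apply Circle.ext
  rw [coe_dir (mul_ne_zero h v.coe_ne_zero), norm_mul, Circle.norm_coe, mul_one,
    Complex.norm_real, Real.norm_of_nonneg hs.le]
  field_simp

theorem dir_smul {s : ℝ} (hs : 0 < s) (z : ℂ) : dir (s * z) = dir z := by
  rcases eq_or_ne z 0 with rfl | hz
  · simp
  · rw [← norm_mul_dir z, ← mul_assoc, ← Complex.ofReal_mul,
      dir_mul (mul_pos hs (norm_pos_iff.2 hz)), dir_mul (norm_pos_iff.2 hz)]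

theorem Continuous.circleDir {X : Type*} [TopologicalSpace X] {f : X → ℂ} (hf : Continuous f)
    (h : ∀ x, f x ≠ 0) : Continuous fun x => dir (f x) := by
  refine continuous_induced_rng.2 ?_
  refine (hf.div (Complex.continuous_ofReal.comp hf.norm) fun x => ?_).congr fun x =>
    (coe_dir (h x)).symm
  simpa using h x

/-! ### Coordinates adapted to a Hopf link -/

/-- A pair of complex functions without common zeros on `S³` that, followed by radial projection,
is a homeomorphism to the unit sphere of `ℂ²`; `inv` is the inverse, extended to be constant on
rays. -/
structure HopfFrame where
  a : S3 → ℂ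
  b : S3 → ℂ
  inv : ℂ × ℂ → S3
  continuous_a : Continuous a
  continuous_b : Continuous b
  ne_zero : ∀ x, a x ≠ 0 ∨ b x ≠ 0
  exists_scale : ∀ p q, p ≠ 0 ∨ q ≠ 0 →
    ∃ s : ℝ, 0 < s ∧ a (inv (p, q)) = s * p ∧ b (inv (p, q)) = s * q
  inv_scale : ∀ (x : S3) (s : ℝ), 0 < s → ∀ p q, a x = s * p → b x = s * q → inv (p, q) = x

namespace HopfFrame

variable (H : HopfFrame)

/-- The frame with the two functions exchanged. -/
def swap : HopfFrame where
  a := H.b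
  b := H.a
  inv := H.inv ∘ Prod.swap
  continuous_a := H.continuous_b
  continuous_b := H.continuous_a
  ne_zero x := (H.ne_zero x).symm
  exists_scale p q h := by
    obtain ⟨s, hs, h1, h2⟩ := H.exists_scale q p h.symm
    exact ⟨s, hs, h2, h1⟩
  inv_scale x s hs p q h1 h2 := H.inv_scale x s hs q p h2 h1

theorem inv_apply (x : S3) : H.inv (H.a x, H.b x) = x :=
  H.inv_scale x 1 one_pos _ _ (by simp) (by simp)

theorem inv_smul {s : ℝ} (hs : 0 < s) {p q : ℂ} (h : p ≠ 0 ∨ q ≠ 0) :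
    H.inv (s * p, s * q) = H.inv (p, q) := by
  obtain ⟨t, ht, h1, h2⟩ := H.exists_scale p q h
  refine H.inv_scale _ (t / s) (div_pos ht hs) _ _ ?_ ?_
  · rw [h1]; push_cast; field_simp [hs.ne']
  · rw [h2]; push_cast; field_simp [hs.ne']

/-- The radial projection of the pair of functions to the unit sphere of `ℂ²`. -/
def toSphere (x : S3) : Metric.sphere (0 : ℂ × ℂ) 1 :=
  ⟨(‖(H.a x, H.b x)‖⁻¹ : ℝ) • (H.a x, H.b x), by
    have : (H.a x, H.b x) ≠ 0 := by
      simp only [ne_eq, Prod.mk_eq_zero, not_and_or]; exact H.ne_zero x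
    rw [mem_sphere_zero_iff_norm, norm_smul, norm_inv, norm_norm,
      inv_mul_cancel₀ (norm_ne_zero_iff.2 this)]⟩

theorem norm_pos (x : S3) : 0 < ‖(H.a x, H.b x)‖ := by
  have : (H.a x, H.b x) ≠ 0 := by
    simp only [ne_eq, Prod.mk_eq_zero, not_and_or]; exact H.ne_zero x
  exact norm_pos_iff.2 this

theorem continuous_toSphere : Continuous H.toSphere := by
  refine Continuous.subtype_mk ?_ _
  have h := H.continuous_a.prodMk H.continuous_b
  exact (h.norm.inv₀ fun x => (H.norm_pos x).ne').smul h

theorem inv_toSphere (x : S3) : H.inv (H.toSphere x) = x := by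
  have h := H.inv_smul (inv_pos.2 (H.norm_pos x)) (H.ne_zero x)
  rw [H.inv_apply] at h
  have h1 : (H.toSphere x : ℂ × ℂ) = (((‖(H.a x, H.b x)‖⁻¹ : ℝ) : ℂ) * H.a x,
      ((‖(H.a x, H.b x)‖⁻¹ : ℝ) : ℂ) * H.b x) := by
    simp only [toSphere, Prod.smul_mk, Complex.real_smul]
  rw [h1]
  exact h

theorem toSphere_inv (z : Metric.sphere (0 : ℂ × ℂ) 1) : H.toSphere (H.inv z) = z := by
  obtain ⟨⟨p, q⟩, hz⟩ := z
  rw [mem_sphere_zero_iff_norm] at hz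
  have h0 : p ≠ 0 ∨ q ≠ 0 := by
    by_contra! h
    simp [h.1, h.2] at hz
  obtain ⟨s, hs, h1, h2⟩ := H.exists_scale p q h0
  apply Subtype.ext
  have h3 : (H.a (H.inv (p, q)), H.b (H.inv (p, q))) = s • (p, q) := by
    rw [h1, h2]; simp
  simp only [toSphere, h3, norm_smul, hz, smul_smul, Real.norm_of_nonneg hs.le, mul_one,
    inv_mul_cancel₀ hs.ne', one_smul]

/-- The three-sphere is homeomorphic to the unit sphere for the maximum norm on `ℂ²`. -/
def homeoSphere : S3 ≃ₜ Metric.sphere (0 : ℂ × ℂ) 1 :=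
  Continuous.homeoOfEquivCompactToT2
    (f := ⟨H.toSphere, fun z => H.inv z, H.inv_toSphere, H.toSphere_inv⟩) H.continuous_toSphere

/-- Compactness controls `inv` only on the unit sphere; constancy on rays carries continuity to all
nonzero pairs. -/
theorem continuousOn_inv : ContinuousOn H.inv {0}ᶜ := by
  rw [continuousOn_iff_continuous_domRestrict]
  have h : ∀ z : ({0}ᶜ : Set (ℂ × ℂ)), 0 < ‖(z : ℂ × ℂ)‖ := fun z => norm_pos_iff.2 z.2
  let N : ({0}ᶜ : Set (ℂ × ℂ)) → Metric.sphere (0 : ℂ × ℂ) 1 := fun z =>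
    ⟨(‖(z : ℂ × ℂ)‖⁻¹ : ℝ) • (z : ℂ × ℂ), by
      rw [mem_sphere_zero_iff_norm, norm_smul, norm_inv, norm_norm, inv_mul_cancel₀ (h z).ne']⟩
  have hN : Continuous N :=
    Continuous.subtype_mk ((continuous_subtype_val.norm.inv₀ fun z => (h z).ne').smul
      continuous_subtype_val) _
  refine (H.homeoSphere.symm.continuous.comp hN).congr fun z => ?_
  obtain ⟨⟨p, q⟩, hz⟩ := z
  have h0 : p ≠ 0 ∨ q ≠ 0 := by
    by_contra! h
    exact hz (by simp [h.1, h.2])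
  have := H.inv_smul (inv_pos.2 (h ⟨(p, q), hz⟩)) h0
  simp only [Function.comp_apply, Set.domRestrict_apply, ← this]
  change H.inv (N ⟨(p, q), hz⟩) = _
  simp [N]

theorem a_inv_eq_zero {q : ℂ} (hq : q ≠ 0) : H.a (H.inv (0, q)) = 0 := by
  obtain ⟨s, -, h, -⟩ := H.exists_scale 0 q (Or.inr hq)
  simpa using h

theorem inv_circle_injective : Function.Injective fun v : Circle => H.inv (0, v) := by
  intro v w h
  obtain ⟨s, hs, -, h1⟩ := H.exists_scale 0 v (Or.inr v.coe_ne_zero)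
  obtain ⟨t, ht, -, h2⟩ := H.exists_scale 0 w (Or.inr w.coe_ne_zero)
  replace h : H.inv (0, v) = H.inv (0, w) := h
  rw [h, h2] at h1
  have h3 := congrArg norm h1
  simp only [norm_mul, Circle.norm_coe, Complex.norm_real, Real.norm_of_nonneg hs.le,
    Real.norm_of_nonneg ht.le, mul_one] at h3
  rw [h3] at h1
  exact Circle.ext (mul_left_cancel₀ (by exact_mod_cast hs.ne') h1).symm

theorem range_inv_circle : Set.range (fun v : Circle => H.inv (0, v)) = {x | H.a x = 0} := by
  ext x
  constructor
  · rintro ⟨v, rfl⟩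
    exact H.a_inv_eq_zero v.coe_ne_zero
  · intro hx
    replace hx : H.a x = 0 := hx
    have hb : H.b x ≠ 0 := (H.ne_zero x).resolve_left fun h => h hx
    exact ⟨dir (H.b x), H.inv_scale x ‖H.b x‖ (norm_pos_iff.2 hb) _ _ (by simp [hx])
      (norm_mul_dir _).symm⟩

end HopfFrame

/-! ### The chain -/

theorem continuous_chainFun (n k : ℕ) : Continuous (chainFun n k) := by
  unfold chainFun
  have h : ∀ x y : ℝ, (⟨x, y⟩ : ℂ) = x + y * Complex.I := fun x y => by
    apply Complex.ext <;> simp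
  simp only [h]
  fun_prop

/-- The imaginary parts force a common zero onto the axis `w = 0`. There it would be equally far
from two centres at distance `π / n`, which requires `2 * r ^ 2 = 1 + cos (π / n)`. The radius is
`3/4` of the spacing instead of `1/2`, and `chainFun_angles` excludes equality. -/
theorem chainFun_ne_zero {n : ℕ} (hn : 2 ≤ n) (k : ℕ) (x : S3) :
    chainFun n k x ≠ 0 ∨ chainFun n (k + 1) x ≠ 0 := by
  by_contra! h
  obtain ⟨hS, hc⟩ := chainFun_angles n hn
  obtain ⟨h1, h2⟩ := h
  have hx : ‖(x : C2)‖ ^ 2 = 1 := by rw [mem_sphere_zero_iff_norm.1 x.2, one_pow]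
  rw [EuclideanSpace.norm_sq_eq, Fin.sum_univ_two] at hx
  set z := (x : C2) 0
  set w := (x : C2) 1
  set a := Real.pi / n with ha
  set r := Real.cos (3 * Real.pi / (4 * n)) with hr
  set e : ℂ := Complex.exp (-(k * Real.pi / n * Complex.I)) with he
  have e1 : Complex.exp (-(((k + 1 : ℕ) : ℂ) * Real.pi / n * Complex.I)) =
      e * ((Real.cos a : ℂ) - Real.sin a * Complex.I) := by
    have : -(((k + 1 : ℕ) : ℂ) * Real.pi / n * Complex.I) =
        -(k * Real.pi / n * Complex.I) + ((-a : ℝ) : ℂ) * Complex.I := by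
      rw [ha]; push_cast; ring
    rw [this, Complex.exp_add, Complex.exp_mul_I]
    rw [← Complex.ofReal_cos, ← Complex.ofReal_sin, Real.cos_neg, Real.sin_neg]
    push_cast; ring
  have hen : ‖e‖ = 1 := by
    have : e = Complex.exp (((-(k * Real.pi / n) : ℝ) : ℂ) * Complex.I) := by
      rw [he]; push_cast; ring_nf
    rw [this, Complex.norm_exp_ofReal_mul_I]
  have f1 : chainFun n k x = ⟨(z * e).re - r, (w * Complex.I ^ k).im⟩ := rfl
  have f2 : chainFun n (k + 1) x = ⟨(z * e).re * Real.cos a + (z * e).im * Real.sin a - r,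
      (w * Complex.I ^ k).re⟩ := by
    unfold chainFun
    rw [e1, ← mul_assoc, pow_succ, ← mul_assoc]
    generalize Real.cos a = c
    generalize Real.sin a = S
    apply Complex.ext
    · simp [Complex.mul_re, Complex.mul_im, hr, z]
    · simp [Complex.mul_im, w]
  rw [f1, Complex.ext_iff] at h1
  rw [f2, Complex.ext_iff] at h2
  obtain ⟨h1, h3⟩ := h1
  obtain ⟨h2, h4⟩ := h2
  simp only [Complex.zero_re, Complex.zero_im] at h1 h2 h3 h4
  have hw : w = 0 := by
    have : w * Complex.I ^ k = 0 := Complex.ext h4 h3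
    exact (mul_eq_zero.1 this).resolve_right (pow_ne_zero _ Complex.I_ne_zero)
  have hz : (z * e).re ^ 2 + (z * e).im ^ 2 = 1 := by
    have : ‖z * e‖ ^ 2 = 1 := by
      rw [norm_mul, hen, mul_one]
      simpa [hw] using hx
    rw [← this, ← Complex.normSq_eq_norm_sq, Complex.normSq_apply]; ring
  have hcs := Real.sin_sq_add_cos_sq a
  clear_value r a
  set c := Real.cos a
  set S := Real.sin a
  have hre : (z * e).re = r := by linarith
  rw [hre] at h2 hz
  have h5 : (z * e).im * S = r * (1 - c) := by linarith
  have h6 : (1 - c) * ((1 + c) - 2 * r ^ 2) = 0 := by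
    have h7 : ((z * e).im * S) ^ 2 = (r * (1 - c)) ^ 2 := by rw [h5]
    linear_combination h7 - S ^ 2 * hz + (r ^ 2 - 1) * hcs
  have hc1 : 0 < 1 - c := by nlinarith [sq_pos_of_pos hS]
  rcases mul_eq_zero.1 h6 with h | h <;> linarith

instance : Nonempty S3 := ⟨⟨!₂[1, 0], by simp [EuclideanSpace.norm_eq]⟩⟩

/-- The frame of the `k`-th and the `(k+1)`-st component. -/
def chainFrame {n : ℕ} (hn : 2 ≤ n) (k : ℕ) : HopfFrame where
  a := chainFun n k
  b := chainFun n (k + 1)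
  -- The default point is used only at `(0, 0)`, where a frame imposes no condition.
  inv z := hopfPoint n k (Classical.arbitrary S3) z.1 z.2
  continuous_a := continuous_chainFun n k
  continuous_b := continuous_chainFun n (k + 1)
  ne_zero := chainFun_ne_zero hn k
  exists_scale p q h := by
    have hex := (existsUnique_chainFun n k hn p q h).exists
    simp only [hopfPoint, dif_pos hex]
    exact hex.choose_spec
  inv_scale x s hs p q h1 h2 := by
    have h : p ≠ 0 ∨ q ≠ 0 := by
      by_contra! h
      rcases chainFun_ne_zero hn k x with h3 | h3
      · exact h3 (by rw [h1, h.1, mul_zero])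
      · exact h3 (by rw [h2, h.2, mul_zero])
    have hex := (existsUnique_chainFun n k hn p q h).exists
    simp only [hopfPoint, dif_pos hex]
    exact (existsUnique_chainFun n k hn p q h).unique hex.choose_spec ⟨s, hs, h1, h2⟩

theorem hopfPoint_eq {n : ℕ} (hn : 2 ≤ n) (k : ℕ) (x : S3) {p q : ℂ} (h : p ≠ 0 ∨ q ≠ 0) :
    hopfPoint n k x p q = (chainFrame hn k).inv (p, q) := by
  have hex := (existsUnique_chainFun n k hn p q h).exists
  simp only [chainFrame, hopfPoint, dif_pos hex]

/-- Since `I ^ (2 * n) = (-1) ^ n`, the imaginary part changes sign for odd `n`. Only the real part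
and the zero set are periodic, which suffices for supports and components. -/
theorem chainFun_add_period {n : ℕ} (hn : 2 ≤ n) (k : ℕ) (x : S3) :
    (chainFun n (k + 2 * n) x).re = (chainFun n k x).re ∧
      (chainFun n (k + 2 * n) x = 0 ↔ chainFun n k x = 0) := by
  have hn' : (n : ℂ) ≠ 0 := by exact_mod_cast (by omega : n ≠ 0)
  have he : Complex.exp (-(((k + 2 * n : ℕ) : ℂ) * Real.pi / n * Complex.I)) =
      Complex.exp (-(k * Real.pi / n * Complex.I)) := by
    rw [Complex.exp_eq_exp_iff_exists_int]
    refine ⟨-1, ?_⟩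
    push_cast
    field_simp
    ring
  have hi : (Complex.I ^ (k + 2 * n) : ℂ) = Complex.I ^ k * ((-1 : ℝ) ^ n : ℝ) := by
    rw [pow_add, pow_mul, Complex.I_sq]; push_cast; rfl
  unfold chainFun
  rw [he, hi]
  refine ⟨rfl, ?_⟩
  rw [Complex.ext_iff, Complex.ext_iff, ← mul_assoc, Complex.im_mul_ofReal]
  simp

theorem chainFun_mod {n : ℕ} (hn : 2 ≤ n) (k : ℕ) (x : S3) :
    (chainFun n k x).re = (chainFun n (k : ZMod (2 * n)).val x).re ∧
      (chainFun n k x = 0 ↔ chainFun n (k : ZMod (2 * n)).val x = 0) := by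
  rw [ZMod.val_natCast]
  obtain ⟨m, hm⟩ : ∃ m, k = k % (2 * n) + m * (2 * n) := ⟨k / (2 * n), by
    exact (Nat.mod_add_div' k (2 * n)).symm⟩
  generalize k % (2 * n) = l at hm
  subst hm
  induction m with
  | zero => simp
  | succ m ih =>
    have := chainFun_add_period hn (l + m * (2 * n)) x
    rw [show l + (m + 1) * (2 * n) = l + m * (2 * n) + 2 * n by ring]
    exact ⟨this.1.trans ih.1, this.2.trans ih.2⟩

theorem chainLink_natCast {n : ℕ} (hn : 2 ≤ n) (k : ℕ) :
    chainLink n (k : ZMod (2 * n)) = {x | chainFun n k x = 0} := by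
  ext x
  exact (chainFun_mod hn k x).2.symm

/-! ### Maps that act on the tori around a Hopf link -/

namespace HopfFrame

variable (H : HopfFrame)

open Classical in
/-- The map of `S³` that acts by `g` on the tori around the Hopf link and is the identity on the
link itself. -/
def torusMap (g : Circle × Circle → Circle × Circle) (x : S3) : S3 :=
  if H.a x = 0 ∨ H.b x = 0 then x
  else H.inv (‖H.a x‖ * (g (dir (H.a x), dir (H.b x))).1,
    ‖H.b x‖ * (g (dir (H.a x), dir (H.b x))).2)

variable {H}

theorem torusMap_of_zero {g : Circle × Circle → Circle × Circle} {x : S3}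
    (h : H.a x = 0 ∨ H.b x = 0) : H.torusMap g x = x := if_pos h

theorem torusMap_of_ne {g : Circle × Circle → Circle × Circle} {x : S3}
    (ha : H.a x ≠ 0) (hb : H.b x ≠ 0) :
    H.torusMap g x = H.inv (‖H.a x‖ * (g (dir (H.a x), dir (H.b x))).1,
      ‖H.b x‖ * (g (dir (H.a x), dir (H.b x))).2) := if_neg (by tauto)

theorem exists_scale_torusMap (g : Circle × Circle → Circle × Circle) {x : S3}
    (ha : H.a x ≠ 0) (hb : H.b x ≠ 0) :
    ∃ s : ℝ, 0 < s ∧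
      H.a (H.torusMap g x) = (s * ‖H.a x‖ : ℝ) * (g (dir (H.a x), dir (H.b x))).1 ∧
      H.b (H.torusMap g x) = (s * ‖H.b x‖ : ℝ) * (g (dir (H.a x), dir (H.b x))).2 := by
  rw [torusMap_of_ne ha hb]
  obtain ⟨s, hs, h1, h2⟩ := H.exists_scale (‖H.a x‖ * (g (dir (H.a x), dir (H.b x))).1)
    (‖H.b x‖ * (g (dir (H.a x), dir (H.b x))).2)
    (Or.inl (mul_ne_zero (by simpa using ha) (Circle.coe_ne_zero _)))
  exact ⟨s, hs, by rw [h1]; push_cast; ring, by rw [h2]; push_cast; ring⟩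

theorem torusMap_ne_zero (g : Circle × Circle → Circle × Circle) {x : S3}
    (ha : H.a x ≠ 0) (hb : H.b x ≠ 0) :
    H.a (H.torusMap g x) ≠ 0 ∧ H.b (H.torusMap g x) ≠ 0 := by
  obtain ⟨s, hs, h1, h2⟩ := exists_scale_torusMap g ha hb
  rw [h1, h2]
  have := norm_pos_iff.2 ha
  have := norm_pos_iff.2 hb
  constructor <;>
  · refine mul_ne_zero ?_ (Circle.coe_ne_zero _)
    have : 0 < s * ‖H.a x‖ := by positivity
    have : 0 < s * ‖H.b x‖ := by positivity
    exact_mod_cast (by assumption : (0 : ℝ) < _).ne'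

/-- A torus map multiplies both moduli by a common factor, to which `inv` is insensitive, so only
the angular actions compose. -/
theorem torusMap_comp (g g' : Circle × Circle → Circle × Circle) (x : S3) :
    H.torusMap (g ∘ g') x = H.torusMap g (H.torusMap g' x) := by
  by_cases h : H.a x = 0 ∨ H.b x = 0
  · simp only [torusMap_of_zero h]
  · push Not at h
    obtain ⟨ha, hb⟩ := h
    have h' := torusMap_ne_zero g' ha hb
    obtain ⟨s, hs, h1, h2⟩ := exists_scale_torusMap g' ha hb
    have pa : 0 < s * ‖H.a x‖ := mul_pos hs (norm_pos_iff.2 ha)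
    have pb : 0 < s * ‖H.b x‖ := mul_pos hs (norm_pos_iff.2 hb)
    rw [torusMap_of_ne h'.1 h'.2, torusMap_of_ne ha hb, h1, h2, dir_mul pa, dir_mul pb]
    simp only [norm_mul, Circle.norm_coe, mul_one, Complex.norm_real, norm_norm,
      Real.norm_of_nonneg hs.le]
    push_cast
    rw [mul_assoc, mul_assoc, H.inv_smul hs]
    · rfl
    · exact Or.inl (mul_ne_zero (by simpa using ha) (Circle.coe_ne_zero _))

theorem torusMap_id (x : S3) : H.torusMap id x = x := by
  by_cases h : H.a x = 0 ∨ H.b x = 0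
  · rw [torusMap_of_zero h]
  · push Not at h
    rw [torusMap_of_ne h.1 h.2]
    simp only [id, norm_mul_dir, H.inv_apply]

theorem bijective_torusMap {g : Circle × Circle → Circle × Circle} (hg : Function.Bijective g) :
    Function.Bijective (H.torusMap g) := by
  obtain ⟨g', h1, h2⟩ := Function.bijective_iff_has_inverse.1 hg
  refine Function.bijective_iff_has_inverse.2 ⟨H.torusMap g', fun x => ?_, fun x => ?_⟩
  · rw [← torusMap_comp, h1.comp_eq_id, torusMap_id]
  · rw [← torusMap_comp, h2.comp_eq_id, torusMap_id]

theorem continuousOn_torusMap {g : Circle × Circle → Circle × Circle} (hg : Continuous g) :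
    ContinuousOn (H.torusMap g) {x | H.a x ≠ 0 ∧ H.b x ≠ 0} := by
  rw [continuousOn_iff_continuous_domRestrict]
  have ha : Continuous fun x : {x | H.a x ≠ 0 ∧ H.b x ≠ 0} => H.a x :=
    H.continuous_a.comp continuous_subtype_val
  have hb : Continuous fun x : {x | H.a x ≠ 0 ∧ H.b x ≠ 0} => H.b x :=
    H.continuous_b.comp continuous_subtype_val
  have hd := hg.comp ((ha.circleDir fun x => x.2.1).prodMk (hb.circleDir fun x => x.2.2))
  have : Continuous fun x : {x | H.a x ≠ 0 ∧ H.b x ≠ 0} =>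
      ((‖H.a x‖ * (g (dir (H.a x), dir (H.b x))).1,
        ‖H.b x‖ * (g (dir (H.a x), dir (H.b x))).2) : ℂ × ℂ) :=
    ((Complex.continuous_ofReal.comp ha.norm).mul
      (continuous_subtype_val.comp (continuous_fst.comp hd))).prodMk
    ((Complex.continuous_ofReal.comp hb.norm).mul
      (continuous_subtype_val.comp (continuous_snd.comp hd)))
  refine (H.continuousOn_inv.comp_continuous this fun x h => ?_).congr fun x =>
    (torusMap_of_ne x.2.1 x.2.2).symm
  have := (Prod.mk_eq_zero.1 h).1
  exact mul_ne_zero (by simpa using x.2.1) (Circle.coe_ne_zero _) this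

theorem torusMap_swap (g : Circle × Circle → Circle × Circle) (x : S3) :
    H.swap.torusMap (Prod.swap ∘ g ∘ Prod.swap) x = H.torusMap g x := by
  unfold torusMap
  simp only [swap, or_comm, Function.comp_apply, Prod.swap]

end HopfFrame

/-! ### Twists of the torus -/

/-- A deformation of the identity map of the circle (at time `0`) to the map that is constant on
the left half circle and doubles the angle on the right half circle (at time `1`). -/
def turn (t : ℝ) (x : Circle) : Circle :=
  x * Circle.exp (t * (Real.pi + Real.arcsin (x : ℂ).im))

theorem turn_zero (x : Circle) : turn 0 x = x := by simp [turn]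

theorem continuous_turn : Continuous fun y : ℝ × Circle => turn y.1 y.2 := by
  unfold turn
  have : Continuous fun y : ℝ × Circle => ((y.2 : Circle) : ℂ).im :=
    Complex.continuous_im.comp (continuous_subtype_val.comp continuous_snd)
  exact continuous_snd.mul (Circle.exp.continuous.comp
    (continuous_fst.mul (continuous_const.add (Real.continuous_arcsin.comp this))))

/-- On the unit circle `exp (i (π + arcsin (im x)))` equals `-(|re x| + i im x)`. This is `-x` on
the right half circle and the conjugate of `x` on the left one; multiplication by `x` gives `-x ^ 2`
and `1`. -/
theorem fullTurn_eq {p : ℂ} (hp : p ≠ 0) : fullTurn p = turn 1 (dir p) := by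
  have hp' : 0 < ‖p‖ := norm_pos_iff.2 hp
  have hd : (p / ‖p‖ : ℂ) = dir p := (coe_dir hp).symm
  have hre : 0 < p.re ↔ 0 < (dir p : ℂ).re := by
    rw [← hd, Complex.div_ofReal_re]
    exact (div_pos_iff_of_pos_right hp').symm
  unfold fullTurn
  rw [hd]
  simp only [hre]
  generalize dir p = x
  have hsq : (x : ℂ).re ^ 2 + (x : ℂ).im ^ 2 = 1 := by
    have h := Complex.sq_norm (x : ℂ)
    rw [Circle.norm_coe, Complex.normSq_apply] at h
    linarith
  have hcos : Real.cos (Real.arcsin (x : ℂ).im) = |(x : ℂ).re| := by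
    rw [Real.cos_arcsin, ← Real.sqrt_sq_eq_abs]
    congr 1
    linarith
  have hsin : Real.sin (Real.arcsin (x : ℂ).im) = (x : ℂ).im :=
    Real.sin_arcsin (by nlinarith) (by nlinarith)
  have hexp : ((Circle.exp (1 * (Real.pi + Real.arcsin (x : ℂ).im)) : Circle) : ℂ) =
      -(|(x : ℂ).re| + (x : ℂ).im * Complex.I) := by
    rw [one_mul, Circle.exp_add, Circle.coe_mul, Circle.coe_exp, Circle.coe_exp,
      Complex.exp_pi_mul_I, Complex.exp_mul_I, ← Complex.ofReal_cos, ← Complex.ofReal_sin,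
      hcos, hsin]
    ring
  rw [turn, Circle.coe_mul, hexp]
  have hx : (x : ℂ) = (x : ℂ).re + (x : ℂ).im * Complex.I := (Complex.re_add_im _).symm
  split_ifs with h
  · rw [abs_of_pos h, ← hx]; ring
  · rw [abs_of_nonpos (not_lt.1 h)]
    generalize (x : ℂ).re = u at *
    generalize (x : ℂ).im = v at *
    rw [hx]
    push_cast
    have : (u : ℂ) ^ 2 + (v : ℂ) ^ 2 = 1 := by exact_mod_cast hsq
    linear_combination (-1 : ℂ) * this + (v : ℂ) ^ 2 * Complex.I_sq

/-- The shear of the torus that is given by a right-handed twist (at time `1`). -/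
def torusRight (t : ℝ) (y : Circle × Circle) : Circle × Circle := (y.1, turn t y.1 * y.2)

/-- The shear of the torus that is given by a left-handed twist (at time `1`). -/
def torusLeft (t : ℝ) (y : Circle × Circle) : Circle × Circle := ((turn t y.2)⁻¹ * y.1, y.2)

/-- The action of an `ml`-swap on the tori around a Hopf link (at time `1`). -/
def torusSwap (t : ℝ) : Circle × Circle → Circle × Circle :=
  torusRight t ∘ torusLeft t ∘ torusRight t

theorem bijective_torusRight (t : ℝ) : Function.Bijective (torusRight t) :=
  Function.bijective_iff_has_inverse.2
    ⟨fun y => (y.1, (turn t y.1)⁻¹ * y.2), fun y => by simp [torusRight],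
      fun y => by simp [torusRight]⟩

theorem bijective_torusLeft (t : ℝ) : Function.Bijective (torusLeft t) :=
  Function.bijective_iff_has_inverse.2
    ⟨fun y => (turn t y.2 * y.1, y.2), fun y => by simp [torusLeft],
      fun y => by simp [torusLeft]⟩

theorem bijective_torusSwap (t : ℝ) : Function.Bijective (torusSwap t) :=
  (bijective_torusRight t).comp ((bijective_torusLeft t).comp (bijective_torusRight t))

/-- The matrix identity behind the theorem: the shears `(1 0; 1 1)`, `(1 -1; 0 1)`, `(1 0; 1 1)`
multiply to the quarter turn `(0 -1; 1 0)`. -/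
theorem torusSwap_zero (y : Circle × Circle) : torusSwap 0 y = (y.2⁻¹, y.1) := by
  simp [torusSwap, torusLeft, torusRight, turn_zero]

theorem continuous_torusSwap : Continuous fun y : ℝ × (Circle × Circle) => torusSwap y.1 y.2 := by
  have hR : Continuous fun y : ℝ × (Circle × Circle) => (y.1, torusRight y.1 y.2) := by
    have := continuous_turn.comp (continuous_fst.prodMk (continuous_fst.comp continuous_snd) :
      Continuous fun y : ℝ × (Circle × Circle) => (y.1, y.2.1))
    unfold torusRight
    exact continuous_fst.prodMk ((continuous_fst.comp continuous_snd).prodMk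
      (this.mul (continuous_snd.comp continuous_snd)))
  have hL : Continuous fun y : ℝ × (Circle × Circle) => (y.1, torusLeft y.1 y.2) := by
    have := continuous_turn.comp (continuous_fst.prodMk (continuous_snd.comp continuous_snd) :
      Continuous fun y : ℝ × (Circle × Circle) => (y.1, y.2.2))
    unfold torusLeft
    exact continuous_fst.prodMk ((this.inv.mul (continuous_fst.comp continuous_snd)).prodMk
      (continuous_snd.comp continuous_snd))
  exact continuous_snd.comp (hR.comp (hL.comp hR))

attribute [irreducible] torusSwap

theorem rightTwist_eq {n : ℕ} (hn : 2 ≤ n) (k : ℕ) (x : S3) :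
    rightTwist n k x = (chainFrame hn k).torusMap (torusRight 1) x := by
  have h0 := chainFun_ne_zero hn k x
  set H := chainFrame hn k with hH
  change H.a x ≠ 0 ∨ H.b x ≠ 0 at h0
  have he : rightTwist n k x = H.inv (H.a x, fullTurn (H.a x) * H.b x) := by
    refine hopfPoint_eq hn k x ?_
    rcases eq_or_ne (H.a x) 0 with ha | ha
    · change H.a x ≠ 0 ∨ fullTurn (H.a x) * H.b x ≠ 0
      rw [ha] at h0 ⊢
      simpa [fullTurn] using h0
    · exact Or.inl ha
  rw [he]
  -- On the link the twist formula already gives the identity: `fullTurn 0 = 1`, and a rotation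
  -- fixes `0`.
  by_cases h : H.a x = 0 ∨ H.b x = 0
  · rw [HopfFrame.torusMap_of_zero h]
    rcases h with h | h
    · have := H.inv_apply x
      rw [h] at this ⊢
      simpa [fullTurn] using this
    · have := H.inv_apply x
      rw [h] at this ⊢
      simpa using this
  · push Not at h
    rw [HopfFrame.torusMap_of_ne h.1 h.2, fullTurn_eq h.1]
    simp only [torusRight, norm_mul_dir, Circle.coe_mul]
    congr 2
    rw [mul_left_comm, norm_mul_dir]

theorem leftTwist_eq {n : ℕ} (hn : 2 ≤ n) (k : ℕ) (x : S3) :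
    leftTwist n k x = (chainFrame hn k).torusMap (torusLeft 1) x := by
  have h0 := chainFun_ne_zero hn k x
  set H := chainFrame hn k with hH
  change H.a x ≠ 0 ∨ H.b x ≠ 0 at h0
  have he : leftTwist n k x = H.inv (star (fullTurn (H.b x)) * H.a x, H.b x) := by
    refine hopfPoint_eq hn k x ?_
    rcases eq_or_ne (H.b x) 0 with hb | hb
    · change star (fullTurn (H.b x)) * H.a x ≠ 0 ∨ H.b x ≠ 0
      rw [hb] at h0 ⊢
      simpa [fullTurn] using h0
    · exact Or.inr hb
  rw [he]
  by_cases h : H.a x = 0 ∨ H.b x = 0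
  · rw [HopfFrame.torusMap_of_zero h]
    rcases h with h | h
    · have := H.inv_apply x
      rw [h] at this ⊢
      simpa using this
    · have := H.inv_apply x
      rw [h] at this ⊢
      simpa [fullTurn] using this
  · push Not at h
    rw [HopfFrame.torusMap_of_ne h.1 h.2, fullTurn_eq h.2]
    simp only [torusLeft, norm_mul_dir, Circle.coe_mul, Circle.coe_inv_eq_conj]
    congr 2
    rw [mul_left_comm, norm_mul_dir]
    rfl

theorem mlSwap_eq {n : ℕ} (hn : 2 ≤ n) (i : ZMod (2 * n)) :
    mlSwap n i = (chainFrame hn i.val).torusMap (torusSwap 1) := by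
  funext x
  rw [mlSwap, rightTwist_eq hn, leftTwist_eq hn, rightTwist_eq hn, torusSwap,
    HopfFrame.torusMap_comp, HopfFrame.torusMap_comp]

theorem bijective_mlSwap {n : ℕ} (hn : 2 ≤ n) (i : ZMod (2 * n)) :
    Function.Bijective (mlSwap n i) := by
  rw [mlSwap_eq hn]
  exact HopfFrame.bijective_torusMap (bijective_torusSwap 1)

/-- An `ml`-swap is the identity outside the product neighbourhoods of its two annuli. -/
theorem mlSwap_of_re_nonpos {n : ℕ} (hn : 2 ≤ n) (i : ZMod (2 * n)) {x : S3}
    (h1 : (chainFun n i.val x).re ≤ 0) (h2 : (chainFun n (i.val + 1) x).re ≤ 0) :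
    mlSwap n i x = x := by
  have hR : rightTwist n i.val x = x := by
    rw [rightTwist, fullTurn, if_neg h1.not_gt, one_mul,
      hopfPoint_eq hn _ _ (chainFun_ne_zero hn _ _)]
    exact (chainFrame hn i.val).inv_apply x
  have hL : leftTwist n i.val x = x := by
    rw [leftTwist, fullTurn, if_neg h2.not_gt, star_one, one_mul,
      hopfPoint_eq hn _ _ (chainFun_ne_zero hn _ _)]
    exact (chainFrame hn i.val).inv_apply x
  rw [mlSwap, hR, hL, hR]

/-! ### Extension over the solid torus glued in by surgery -/

/-- Polar coordinates on the solid torus. -/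
def polar (y : unitInterval × (Circle × Circle)) : Disk × Circle :=
  (⟨(y.1 : ℝ) * (y.2.1 : ℂ), by
    simpa [abs_of_nonneg y.1.2.1, Circle.norm_coe] using y.1.2.2⟩, y.2.2)

theorem polar_surjective : Function.Surjective polar := by
  rintro ⟨⟨w, hw⟩, v⟩
  refine ⟨(⟨‖w‖, norm_nonneg w, mem_closedBall_zero_iff.1 hw⟩, (dir w, v)), ?_⟩
  simp [polar, norm_mul_dir]

theorem isQuotientMap_polar : Topology.IsQuotientMap polar := by
  refine Topology.IsQuotientMap.of_surjective_continuous polar_surjective ?_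
  unfold polar
  fun_prop

theorem polar_one (u v : Circle) : polar (1, (u, v)) = (diskBoundary u, v) := by
  simp [polar, diskBoundary]

theorem polar_zero (u v : Circle) : polar (0, (u, v)) = (diskCentre, v) := by
  simp [polar, diskCentre]

/-- A map defined in polar coordinates descends to the solid torus. -/
theorem exists_polar_factor {Z : Type*} [TopologicalSpace Z]
    {Γ : unitInterval × (Circle × Circle) → Z} (hΓ : Continuous Γ)
    (h0 : ∀ u u' v, Γ (0, (u, v)) = Γ (0, (u', v))) :
    ∃ G : Disk × Circle → Z, Continuous G ∧ ∀ y, G (polar y) = Γ y := by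
  have hfac : ∀ y y', polar y = polar y' → Γ y = Γ y' := by
    rintro ⟨r, u, v⟩ ⟨r', u', v'⟩ h
    simp only [polar, Prod.mk.injEq, Subtype.mk.injEq] at h
    obtain ⟨h1, rfl⟩ := h
    have hr : r = r' := by
      have := congrArg norm h1
      simp only [norm_mul, Circle.norm_coe, mul_one, Complex.norm_real,
        Real.norm_of_nonneg r.2.1, Real.norm_of_nonneg r'.2.1] at this
      exact Subtype.ext this
    subst hr
    rcases eq_or_ne r 0 with rfl | hr
    · exact h0 u u' v
    · have : ((r : ℝ) : ℂ) ≠ 0 := by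
        simpa using fun h => hr (Subtype.ext h)
      rw [Circle.ext (mul_left_cancel₀ this h1)]
  have hG : ∀ y, Γ (Function.surjInv polar_surjective (polar y)) = Γ y := fun y =>
    hfac _ _ (Function.surjInv_eq polar_surjective _)
  refine ⟨fun z => Γ (Function.surjInv polar_surjective z), ?_, hG⟩
  rw [isQuotientMap_polar.continuous_iff]
  exact hΓ.congr fun y => (hG y).symm

/-- A torus map extends over the solid torus that is glued in by `0`-surgery on one component of
the Hopf link, if it is isotopic to a map that exchanges the two factors and the tube is isotopic,
in polar coordinates, to one that preserves them. Here `P` is the first coordinate of the tube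
divided by the radius. -/
theorem HopfFrame.exists_extension (H : HopfFrame) {φ : ℂ × Circle → S3} (hφ : Continuous φ)
    (hinj : Function.Injective φ) (hcore : Set.range (fun v => φ (0, v)) = {x | H.a x = 0})
    (hb : ∀ u v, ‖u‖ ≤ 1 → H.b (φ (u, v)) ≠ 0)
    {P : unitInterval × (Circle × Circle) → ℂ} (hP : Continuous P) (hP0 : ∀ y, P y ≠ 0)
    (haP : ∀ (r : unitInterval) (θ v : Circle),
      H.a (φ ((r : ℝ) * θ, v)) = (r : ℝ) * P (r, (θ, v)))
    {B g : unitInterval × (Circle × Circle) → Circle × Circle} (hB : Continuous B)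
    (hBbij : ∀ t, Function.Bijective fun y => B (t, y))
    (hB1 : ∀ θ v, B (1, (θ, v)) = (dir (P (0, (θ, v))), dir (H.b (φ (0, v)))))
    {κ c : Circle → Circle} (hB0 : ∀ θ v, B (0, (θ, v)) = (κ θ, c v))
    (hg : Continuous g) (hgbij : ∀ t, Function.Bijective fun y => g (t, y))
    {χ₁ χ₂ : Circle → Circle} (hg0 : ∀ α β, g (0, (α, β)) = (χ₁ β, χ₂ α)) :
    ∃ G : Disk × Circle → S3, Continuous G ∧ Function.Injective G ∧
      (∀ u v, G (diskBoundary u, v) = H.torusMap (fun y => g (1, y)) (φ (v, u))) ∧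
      Set.range G = H.torusMap (fun y => g (1, y)) '' (φ '' (Metric.closedBall 0 1 ×ˢ Set.univ)) ∧
      Set.range (fun v => G (diskCentre, v)) = {x | H.a x = 0} := by
  set g₁ : Circle × Circle → Circle × Circle := fun y => g (1, y) with hg₁
  have hg₁c : Continuous g₁ := hg.comp (by fun_prop)
  have hcomp : Continuous fun y => g₁ (B (1, y)) := hg₁c.comp (hB.comp (by fun_prop))
  -- `E` takes the angular coordinates of the tube to the limiting angles at radius zero, after the
  -- torus map.
  let E : Circle × Circle ≃ₜ Circle × Circle :=
    (isHomeomorph_iff_continuous_bijective.2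
      ⟨hcomp, (hgbij 1).comp (hBbij 1)⟩).homeomorph fun y => g₁ (B (1, y))
  have hE : ∀ y, E y = g₁ (B (1, y)) := fun y => rfl
  -- the reparametrization of the torus of radius `r`, after exchanging the factors
  let h : unitInterval × (Circle × Circle) → Circle × Circle := fun y =>
    E.symm (g (y.1, B (y.1, (y.2.2, y.2.1))))
  have hh : Continuous h :=
    E.symm.continuous.comp (hg.comp (continuous_fst.prodMk (hB.comp (by fun_prop))))
  have hhbij : ∀ r, Function.Bijective fun y => h (r, y) := fun r =>
    E.symm.bijective.comp ((hgbij r).comp ((hBbij r).comp Prod.swap_bijective))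
  have hh1 : ∀ u v, h (1, (u, v)) = (v, u) := fun u v =>
    E.symm_apply_apply (v, u)
  -- The purpose of `h`: at radius zero the factor `E` cancels and leaves `g₀ ∘ B₀` after the
  -- exchange of factors, whose second coordinate does not involve `u`.
  have hh0 : ∀ u v, g₁ (B (1, h (0, (u, v)))) = (χ₁ (c u), χ₂ (κ v)) := by
    intro u v
    rw [← hE]
    simp only [h, E.apply_symm_apply, hB0, hg0]
  have hχκ : Function.Injective fun v => χ₂ (κ v) := by
    intro v w hvw
    have := (hhbij 0).1 (E.injective (((hE _).trans (hh0 1 v)).trans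
      (Eq.trans (by simp only at hvw; rw [hvw]) ((hE _).trans (hh0 1 w)).symm)))
    exact (Prod.mk.inj this).2
  let ψ : unitInterval × (Circle × Circle) → S3 := fun y => φ ((y.1 : ℝ) * (h y).1, (h y).2)
  have hψ : Continuous ψ := hφ.comp (by fun_prop)
  have hnorm : ∀ (r : unitInterval) (θ : Circle), ‖((r : ℝ) : ℂ) * θ‖ = r := fun r θ => by
    simp [abs_of_nonneg r.2.1, Circle.norm_coe]
  have hbψ : ∀ y, H.b (ψ y) ≠ 0 := fun y => hb _ _ ((hnorm _ _).trans_le y.1.2.2)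
  let P' : unitInterval × (Circle × Circle) → ℂ := fun y => P (y.1, h y)
  have hP' : Continuous P' := hP.comp (continuous_fst.prodMk hh)
  have haψ : ∀ y, H.a (ψ y) = (y.1 : ℝ) * P' y := fun y => haP y.1 (h y).1 (h y).2
  let γ : unitInterval × (Circle × Circle) → Circle × Circle := fun y =>
    g₁ (dir (P' y), dir (H.b (ψ y)))
  have hbψc : Continuous fun y => H.b (ψ y) := H.continuous_b.comp hψ
  have hγ : Continuous γ :=
    hg₁c.comp ((hP'.circleDir fun y => hP0 _).prodMk (hbψc.circleDir hbψ))
  -- For positive radius this is the torus map applied to `ψ`; written through `P'`, it stays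
  -- continuous at radius zero, where the first coordinate vanishes and only `χ₂ (κ v)` remains.
  let Γ : unitInterval × (Circle × Circle) → S3 := fun y =>
    H.inv (((y.1 : ℝ) * ‖P' y‖ : ℝ) * (γ y).1, ‖H.b (ψ y)‖ * (γ y).2)
  have hΓ : Continuous Γ := by
    have h1 : Continuous fun y : unitInterval × (Circle × Circle) =>
        ((((y.1 : ℝ) * ‖P' y‖ : ℝ) * (γ y).1, ‖H.b (ψ y)‖ * (γ y).2) : ℂ × ℂ) := by
      have e1 := hP'.norm
      have e2 := hbψc.norm
      fun_prop
    refine H.continuousOn_inv.comp_continuous h1 fun y h0 => ?_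
    exact mul_ne_zero (by simpa using hbψ y) (Circle.coe_ne_zero _) (Prod.mk_eq_zero.1 h0).2
  have hΓ0 : ∀ u v, Γ (0, (u, v)) = H.inv (0, χ₂ (κ v)) := by
    intro u v
    have h1 : γ (0, (u, v)) = (χ₁ (c u), χ₂ (κ v)) := by
      rw [← hh0 u v]
      change g₁ _ = g₁ (B (1, ((h (0, (u, v))).1, (h (0, (u, v))).2)))
      rw [hB1]
      congr 3
      simp [ψ]
    have hb0 : 0 < ‖H.b (ψ (0, (u, v)))‖ := norm_pos_iff.2 (hbψ _)
    have := H.inv_smul hb0 (p := 0) (q := χ₂ (κ v)) (Or.inr (Circle.coe_ne_zero _))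
    rw [← this]
    simp only [Γ, h1]
    simp
  have hΓpos : ∀ y : unitInterval × (Circle × Circle), y.1 ≠ 0 →
      Γ y = H.torusMap g₁ (ψ y) := by
    intro y hy
    have hy0 : (0 : ℝ) < y.1 := lt_of_le_of_ne y.1.2.1 fun h => hy (Subtype.ext h.symm)
    have hne : H.a (ψ y) ≠ 0 := by
      rw [haψ]
      exact mul_ne_zero (by exact_mod_cast hy0.ne') (hP0 _)
    rw [torusMap_of_ne hne (hbψ y), haψ, dir_smul hy0, norm_mul, Complex.norm_real,
      Real.norm_of_nonneg hy0.le]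
  obtain ⟨G, hGc, hG⟩ := exists_polar_factor hΓ fun u u' v => (hΓ0 u v).trans (hΓ0 u' v).symm
  have hΓa : ∀ y, H.a (Γ y) = 0 ↔ y.1 = 0 := by
    rintro ⟨r, u, v⟩
    constructor
    · intro h0
      by_contra hr
      rw [hΓpos _ hr] at h0
      have hne : H.a (ψ (r, u, v)) ≠ 0 := by
        rw [haψ]
        exact mul_ne_zero (by simpa using fun h => hr (Subtype.ext h)) (hP0 _)
      exact (torusMap_ne_zero g₁ hne (hbψ _)).1 h0
    · rintro (rfl : r = 0)
      rw [hΓ0]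
      exact H.a_inv_eq_zero (Circle.coe_ne_zero _)
  have hTinj : Function.Injective (H.torusMap g₁) := (bijective_torusMap (hgbij 1)).1
  have hrange : Set.range (fun v => G (diskCentre, v)) = {x | H.a x = 0} := by
    have e : ∀ v, G (diskCentre, v) = H.inv (0, χ₂ (κ v)) := fun v => by
      rw [← polar_zero 1 v, hG, hΓ0]
    rw [← H.range_inv_circle]
    ext x
    constructor
    · rintro ⟨v, rfl⟩
      exact ⟨χ₂ (κ v), (e v).symm⟩
    · rintro ⟨w, rfl⟩
      obtain ⟨y, hy⟩ := E.surjective (1, w)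
      obtain ⟨⟨u, v⟩, rfl⟩ := (hhbij 0).2 y
      have := (Prod.mk.inj ((hh0 u v).symm.trans hy)).2
      exact ⟨v, by simp only [e, this]⟩
  refine ⟨G, hGc, ?_, fun u v => ?_, ?_, ?_⟩
  · intro z z' hzz
    obtain ⟨⟨r, u, v⟩, rfl⟩ := polar_surjective z
    obtain ⟨⟨r', u', v'⟩, rfl⟩ := polar_surjective z'
    rw [hG, hG] at hzz
    have hiff : r = 0 ↔ r' = 0 := by
      rw [← hΓa (r, (u, v)), ← hΓa (r', (u', v')), hzz]
    by_cases hr : r = 0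
    · obtain rfl := hr
      obtain rfl := hiff.1 rfl
      rw [hΓ0, hΓ0] at hzz
      rw [polar_zero, polar_zero, hχκ (H.inv_circle_injective hzz)]
    · have hr' : r' ≠ 0 := fun h => hr (hiff.2 h)
      rw [hΓpos _ hr, hΓpos _ hr'] at hzz
      have h1 := hinj (hTinj hzz)
      have h2 := (Prod.mk.inj h1).1
      have h3 := (Prod.mk.inj h1).2
      have hrr : r = r' := by
        have := congrArg norm h2
        rw [hnorm, hnorm] at this
        exact Subtype.ext this
      subst hrr
      have hr0 : ((r : ℝ) : ℂ) ≠ 0 := by simpa using fun h => hr (Subtype.ext h)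
      have h4 := (hhbij r).1 (Prod.ext (Circle.ext (mul_left_cancel₀ hr0 h2)) h3)
      rw [h4]
  · rw [← polar_one, hG, hΓpos _ one_ne_zero]
    simp [ψ, hh1]
  · ext x
    constructor
    · rintro ⟨z, rfl⟩
      obtain ⟨⟨r, u, v⟩, rfl⟩ := polar_surjective z
      rw [hG]
      by_cases hr : r = 0
      · have h0 : Γ (r, (u, v)) ∈ {x | H.a x = 0} := (hΓa _).2 hr
        refine ⟨Γ (r, (u, v)), ?_, torusMap_of_zero (Or.inl h0)⟩
        rw [← hcore] at h0
        obtain ⟨w, hw⟩ := h0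
        exact ⟨(0, w), by simp, hw⟩
      · rw [hΓpos _ hr]
        exact ⟨_, ⟨_, ⟨mem_closedBall_zero_iff.2 ((hnorm _ _).trans_le r.2.2), trivial⟩, rfl⟩, rfl⟩
    · rintro ⟨_, ⟨⟨u, v⟩, ⟨hu, -⟩, rfl⟩, rfl⟩
      by_cases hu0 : u = 0
      · have h0 : φ (u, v) ∈ {x | H.a x = 0} := by
          rw [← hcore, hu0]
          exact ⟨v, rfl⟩
        rw [torusMap_of_zero (Or.inl h0)]
        rw [← hrange] at h0
        obtain ⟨w, hw⟩ := h0
        exact ⟨_, hw⟩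
      · obtain ⟨y, hy⟩ := (hhbij ⟨‖u‖, norm_nonneg u, mem_closedBall_zero_iff.1 hu⟩).2 (dir u, v)
        refine ⟨polar (⟨‖u‖, norm_nonneg u, mem_closedBall_zero_iff.1 hu⟩, y), ?_⟩
        rw [hG, hΓpos _ fun h => hu0 (norm_eq_zero.1 (congrArg Subtype.val h))]
        simp only at hy
        simp only [ψ, hy, norm_mul_dir]
  · exact hrange

/-! ### Blow-up of a tube along its core -/

/-- The linear part of `chainFun n k`. -/
def chainLin (n k : ℕ) : C2 →L[ℝ] ℂ :=
  LinearMap.toContinuousLinearMap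
    { toFun := fun x => ⟨(x 0 * Complex.exp (-(k * Real.pi / n * Complex.I))).re,
        (x 1 * Complex.I ^ k).im⟩
      map_add' := fun x y => by apply Complex.ext <;> simp [add_mul]
      map_smul' := fun c x => by apply Complex.ext <;> simp [mul_assoc, mul_sub] }

theorem chainLin_apply (n k : ℕ) (x : C2) :
    chainLin n k x = ⟨(x 0 * Complex.exp (-(k * Real.pi / n * Complex.I))).re,
      (x 1 * Complex.I ^ k).im⟩ := rfl

theorem chainFun_eq (n k : ℕ) (x : S3) :
    chainFun n k x = chainLin n k x - (Real.cos (3 * Real.pi / (4 * n)) : ℝ) := by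
  apply Complex.ext <;> simp only [chainFun, chainLin_apply, Complex.sub_re, Complex.sub_im,
    Complex.ofReal_re, Complex.ofReal_im, sub_zero]

theorem cos_radius_sq_lt_one {n : ℕ} (hn : 2 ≤ n) :
    Real.cos (3 * Real.pi / (4 * n)) ^ 2 < 1 := by
  have h := (chainFun_angles n hn).2
  have := Real.cos_le_one (Real.pi / n)
  linarith

theorem norm_sq_rotate (n k : ℕ) (x : C2) :
    ‖x‖ ^ 2 = ‖x 0 * Complex.exp (-(k * Real.pi / n * Complex.I))‖ ^ 2 +
      ‖x 1 * Complex.I ^ k‖ ^ 2 := by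
  have : ‖Complex.exp (-(k * Real.pi / n * Complex.I))‖ = 1 := by
    rw [show -(k * Real.pi / n * Complex.I) = ((-(k * Real.pi / n) : ℝ) : ℂ) * Complex.I by
      push_cast; ring, Complex.norm_exp_ofReal_mul_I]
  rw [EuclideanSpace.norm_sq_eq, Fin.sum_univ_two]
  simp [this]

/-- Two vectors tangent to `S³` at a point of a component of the chain and in the kernel of the
linear part of its function are linearly dependent. -/
theorem exists_dependent {n : ℕ} (hn : 2 ≤ n) (k : ℕ) {x : S3} (hx : chainFun n k x = 0)
    {ξ η : C2} (hξ : chainLin n k ξ = 0) (hη : chainLin n k η = 0)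
    (hξx : inner ℝ (x : C2) ξ = 0) (hηx : inner ℝ (x : C2) η = 0) (hη0 : η ≠ 0) :
    ∃ c : ℝ, ξ = c • η := by
  set e : ℂ := Complex.exp (-(k * Real.pi / n * Complex.I)) with he
  set f : ℂ := Complex.I ^ k with hf
  set r := Real.cos (3 * Real.pi / (4 * n)) with hr
  have he0 : e ≠ 0 := Complex.exp_ne_zero _
  have hf0 : f ≠ 0 := pow_ne_zero _ Complex.I_ne_zero
  -- The real inner product in the rotated coordinates, by polarization of `norm_sq_rotate`.
  have hpol : ∀ y z : C2, inner ℝ y z =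
      (y 0 * e).re * (z 0 * e).re + (y 0 * e).im * (z 0 * e).im +
      ((y 1 * f).re * (z 1 * f).re + (y 1 * f).im * (z 1 * f).im) := by
    intro y z
    have hns : ∀ w : ℂ, ‖w‖ ^ 2 = w.re ^ 2 + w.im ^ 2 := fun w => by
      rw [← Complex.normSq_eq_norm_sq, Complex.normSq_apply]; ring
    have h1 := norm_sq_rotate n k (y + z)
    have h2 := norm_sq_rotate n k y
    have h3 := norm_sq_rotate n k z
    have h4 := norm_add_sq_real y z
    simp only [← he, ← hf, PiLp.add_apply, add_mul, hns, Complex.add_re, Complex.add_im]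
      at h1 h2 h3
    linarith
  have hdec : ∀ z : C2, chainLin n k z = 0 → (z 0 * e).re = 0 ∧ (z 1 * f).im = 0 := by
    intro z hz
    rw [chainLin_apply, Complex.ext_iff] at hz
    exact hz
  obtain ⟨a1, a2⟩ := hdec ξ hξ
  obtain ⟨b1, b2⟩ := hdec η hη
  rw [hpol, a1, a2] at hξx
  rw [hpol, b1, b2] at hηx
  have hx1 : ((x : C2) 0 * e).re = r ∧ ((x : C2) 1 * f).im = 0 := by
    have := hx
    rw [chainFun, Complex.ext_iff] at this
    exact ⟨by have := this.1; simp only [Complex.zero_re] at this; linarith, this.2⟩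
  have hxn : inner ℝ (x : C2) (x : C2) = 1 := by
    rw [real_inner_self_eq_norm_sq, mem_sphere_zero_iff_norm.1 x.2, one_pow]
  rw [hpol, hx1.1, hx1.2] at hxn
  have hr1 := cos_radius_sq_lt_one hn
  rw [← hr] at hr1
  set m1 := ((x : C2) 0 * e).im
  set m2 := ((x : C2) 1 * f).re
  set α := (ξ 0 * e).im with hα
  set β := (ξ 1 * f).re with hβ
  set α' := (η 0 * e).im with hα'
  set β' := (η 1 * f).re with hβ'
  have hm : 0 < m1 * m1 + m2 * m2 := by nlinarith
  -- Both vectors lie in the plane of the circle and are orthogonal there to the nonzero vector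
  -- `(m1, m2)`, hence parallel.
  have hdet : α * β' - α' * β = 0 := by
    have h1 : m1 * (α * β' - α' * β) = 0 := by linear_combination β' * hξx - β * hηx
    have h2 : m2 * (α * β' - α' * β) = 0 := by linear_combination α * hηx - α' * hξx
    by_contra h
    have e1 := (mul_eq_zero.1 h1).resolve_right h
    have e2 := (mul_eq_zero.1 h2).resolve_right h
    rw [e1, e2] at hm
    simp at hm
  have hext : ∀ z : C2, (z 0 * e).re = 0 → (z 1 * f).im = 0 → ∀ w : C2, (w 0 * e).re = 0 →
      (w 1 * f).im = 0 → ∀ c : ℝ, (z 0 * e).im = c * (w 0 * e).im →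
      (z 1 * f).re = c * (w 1 * f).re → z = c • w := by
    intro z z1 z2 w w1 w2 c h1 h2
    ext i
    fin_cases i
    · refine mul_right_cancel₀ he0 (Complex.ext ?_ ?_)
      · simp only [Fin.zero_eta, PiLp.smul_apply, smul_mul_assoc, Complex.smul_re, z1, w1]; simp
      · simp only [Fin.zero_eta, PiLp.smul_apply, smul_mul_assoc, Complex.smul_im, h1]; simp
    · refine mul_right_cancel₀ hf0 (Complex.ext ?_ ?_)
      · simp only [Fin.mk_one, PiLp.smul_apply, smul_mul_assoc, Complex.smul_re, h2]; simp
      · simp only [Fin.mk_one, PiLp.smul_apply, smul_mul_assoc, Complex.smul_im, z2, w2]; simp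
  have hη' : α' ≠ 0 ∨ β' ≠ 0 := by
    by_contra! h
    apply hη0
    rw [hext η b1 b2 0 (by simp) (by simp) 0 (by rw [← hα', h.1]; simp)
      (by rw [← hβ', h.2]; simp), smul_zero]
  rcases hη' with h | h
  · refine ⟨α / α', hext ξ a1 a2 η b1 b2 _ ?_ ?_⟩
    · rw [← hα, ← hα']; field_simp
    · rw [← hβ, ← hβ']; field_simp; linarith
  · refine ⟨β / β', hext ξ a1 a2 η b1 b2 _ ?_ ?_⟩
    · rw [← hα, ← hα']; field_simp; linarith
    · rw [← hβ, ← hβ']; field_simp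

namespace TubeSystem

variable {ι : Type} {K : ι → Set S3} (T : TubeSystem K)

/-- The first coordinate of a tube of a component of the chain in polar coordinates: it is the
radius times a nowhere vanishing continuous function whose restriction to radius `0` is linear on
the fibres. -/
theorem exists_blowup {n : ℕ} (hn : 2 ≤ n) (k : ℕ) (j : ι) (hK : K j = {x | chainFun n k x = 0}) :
    ∃ P : unitInterval × (Circle × Circle) → ℂ, Continuous P ∧ (∀ y, P y ≠ 0) ∧
      (∀ (r : unitInterval) (θ v : Circle),
        chainFun n k (T.tube j ((r : ℝ) * θ, v)) = (r : ℝ) * P (r, (θ, v))) ∧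
      ∃ l : Circle → ℂ →L[ℝ] ℂ, (∀ v, Function.Injective (l v)) ∧
        ∀ θ v : Circle, P (0, (θ, v)) = l v θ := by
  set φ := fun y : ℂ × ℝ => (T.tube j (y.1, Circle.exp y.2) : C2) with hφ
  have hφs : ContDiff ℝ ∞ φ := T.smooth j
  set p : ℂ × ℝ → ℂ := fun y => chainFun n k (T.tube j (y.1, Circle.exp y.2)) with hp
  have hpe : p = fun y => chainLin n k (φ y) - (Real.cos (3 * Real.pi / (4 * n)) : ℝ) := by
    funext y; exact chainFun_eq n k _
  have hps : ContDiff ℝ ∞ p := by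
    rw [hpe]; exact ((chainLin n k).contDiff.comp hφs).sub contDiff_const
  have hφd : ∀ y, HasFDerivAt φ (fderiv ℝ φ y) y := fun y =>
    (hφs.differentiable (by simp)).differentiableAt.hasFDerivAt
  have hpd : ∀ y, HasFDerivAt p ((chainLin n k).comp (fderiv ℝ φ y)) y := fun y => by
    rw [hpe]; exact ((chainLin n k).hasFDerivAt.comp y (hφd y)).sub_const _
  have hp0 : ∀ u t, p (u, t) = 0 ↔ u = 0 := by
    intro u t
    have h1 : p (u, t) = 0 ↔ T.tube j (u, Circle.exp t) ∈ K j := by rw [hK]; rfl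
    rw [h1, ← T.core j]
    constructor
    · rintro ⟨v, hv⟩
      exact (Prod.mk.inj (T.injective j hv)).1.symm
    · rintro rfl
      exact ⟨_, rfl⟩
  set q : Circle → ℂ → ℂ := fun v u => chainFun n k (T.tube j (u, v)) with hq
  have hqd : ∀ u t, fderiv ℝ (q (Circle.exp t)) u =
      (fderiv ℝ p (u, t)).comp (ContinuousLinearMap.inl ℝ ℂ ℝ) := by
    intro u t
    have h1 : HasFDerivAt (fun u : ℂ => (u, t)) (ContinuousLinearMap.inl ℝ ℂ ℝ) u :=
      hasFDerivAt_prodMk_left u t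
    exact ((hpd (u, t)).differentiableAt.hasFDerivAt.comp u h1).fderiv
  have hfd : Continuous (fderiv ℝ p) := hps.continuous_fderiv (by simp)
  -- Hadamard's quotient: the integral of the radial derivative along the segment from the core, so
  -- that the factor `r` splits off. The derivative is taken of `q`, which depends on the point of
  -- the circle and not on its lift.
  let P : unitInterval × (Circle × Circle) → ℂ := fun y =>
    ∫ s in (0 : ℝ)..1, fderiv ℝ (q y.2.2) ((s * y.1 : ℝ) * (y.2.1 : ℂ)) (y.2.1 : ℂ)
  have hPc : Continuous P := by
    have h1 : Continuous fun z : (unitInterval × Circle) × Circle => P (z.1.1, (z.1.2, z.2)) := by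
      rw [continuous_comp_circleExp_iff]
      refine intervalIntegral.continuous_parametric_intervalIntegral_of_continuous' ?_ 0 1
      simp only [hqd, Function.uncurry_def, ContinuousLinearMap.comp_apply,
        ContinuousLinearMap.inl_apply]
      refine (hfd.comp ?_).clm_apply ?_ <;> fun_prop
    exact h1.comp (f := fun y : unitInterval × (Circle × Circle) => ((y.1, y.2.1), y.2.2))
      (by fun_prop)
  have hPr : ∀ (r : unitInterval) (θ v : Circle), q v ((r : ℝ) * θ) = (r : ℝ) * P (r, (θ, v)) := by
    intro r θ v
    obtain ⟨t, rfl⟩ := Circle.exp_surjective v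
    have h1 : ∀ s : ℝ, HasDerivAt (fun s : ℝ => p (((s * r : ℝ) : ℂ) * θ, t))
        (((r : ℝ) : ℂ) * fderiv ℝ (q (Circle.exp t)) ((s * r : ℝ) * (θ : ℂ)) θ) s := by
      intro s
      have h2 : HasDerivAt (fun s : ℝ => ((((s * r : ℝ) : ℂ) * θ, t) : ℂ × ℝ))
          (((r : ℝ) : ℂ) * θ, 0) s := by
        refine HasDerivAt.prodMk ?_ (hasDerivAt_const _ _)
        have h3 : HasDerivAt (fun s : ℝ => s * (r : ℝ)) r s := by
          simpa using (hasDerivAt_id s).mul_const (r : ℝ)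
        exact h3.ofReal_comp.mul_const _
      have h4 := (hpd (((s * r : ℝ) : ℂ) * θ, t)).differentiableAt.hasFDerivAt.comp_hasDerivAt s h2
      rw [hqd]
      refine h4.congr_deriv ?_
      have h5 : ((((r : ℝ) : ℂ) * θ, 0) : ℂ × ℝ) = (r : ℝ) • ((θ : ℂ), (0 : ℝ)) := by simp
      rw [h5, map_smul]
      simp
    have h6 := intervalIntegral.integral_eq_sub_of_hasDerivAt (a := 0) (b := 1)
      (fun s _ => h1 s) ?_
    · rw [intervalIntegral.integral_const_mul] at h6
      rw [h6]
      simp only [one_mul, zero_mul, Complex.ofReal_zero, (hp0 0 t).2 rfl, sub_zero]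
      rfl
    · refine Continuous.intervalIntegrable ?_ _ _
      simp only [hqd, ContinuousLinearMap.comp_apply, ContinuousLinearMap.inl_apply]
      refine continuous_const.mul ((hfd.comp ?_).clm_apply ?_) <;> fun_prop
  have hP0 : ∀ θ v : Circle, P (0, (θ, v)) = fderiv ℝ (q v) 0 θ := by
    intro θ v
    simp [P]
  -- The function vanishes along the core, and the tangent vectors that its derivative kills are
  -- multiples of the core direction. As the tube is an immersion, no nonzero fibre vector maps to
  -- such a multiple.
  have hinj : ∀ v, Function.Injective (fderiv ℝ (q v) 0) := by
    intro v
    obtain ⟨t, rfl⟩ := Circle.exp_surjective v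
    rw [hqd, injective_iff_map_eq_zero]
    intro u hu
    rw [(hpd (0, t)).fderiv] at hu
    have hη : chainLin n k (fderiv ℝ φ (0, t) (0, 1)) = 0 := by
      have h1 : HasDerivAt (fun s : ℝ => ((0, s) : ℂ × ℝ)) (0, 1) t :=
        (hasDerivAt_const _ _).prodMk (hasDerivAt_id _)
      have h2 := (hpd (0, t)).comp_hasDerivAt t h1
      have h3 : (p ∘ fun s : ℝ => ((0, s) : ℂ × ℝ)) = fun _ => 0 := by
        funext s; exact (hp0 0 s).2 rfl
      rw [h3] at h2
      exact h2.unique (hasDerivAt_const _ _)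
    obtain ⟨c, hc⟩ := exists_dependent hn k (x := T.tube j (0, Circle.exp t)) ((hp0 0 t).2 rfl)
      hu hη (T.inner_fderiv_tube j (0, t) _) (T.inner_fderiv_tube j (0, t) _) (fun h => by
        have := T.immersion j (0, t) (h.trans (map_zero _).symm)
        simp at this)
    have h4 := T.immersion j (0, t) (hc.trans (map_smul _ _ _).symm)
    simp only [Prod.smul_mk, smul_zero] at h4
    exact (Prod.mk.inj h4).1
  refine ⟨P, hPc, ?_, hPr, fun v => fderiv ℝ (q v) 0, hinj, hP0⟩
  rintro ⟨r, θ, v⟩ h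
  by_cases hr : r = 0
  · subst hr
    rw [hP0] at h
    exact θ.coe_ne_zero (hinj v (h.trans (map_zero _).symm))
  · have h1 := hPr r θ v
    rw [h, mul_zero] at h1
    obtain ⟨t, rfl⟩ := Circle.exp_surjective v
    have h2 := (hp0 _ t).1 h1
    refine mul_ne_zero ?_ θ.coe_ne_zero h2
    simpa using fun h => hr (Subtype.ext h)

end TubeSystem

/-! ### Straightening the fibres -/

/-- The action of an injective real-linear map on directions. -/
theorem bijective_dir_linear (A : ℂ →ₗ[ℝ] ℂ) (hA : Function.Injective A) :
    Function.Bijective fun θ : Circle => dir (A θ) := by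
  have h0 : ∀ θ : Circle, A θ ≠ 0 := fun θ h =>
    θ.coe_ne_zero (hA (h.trans (map_zero A).symm))
  have hs : ∀ (s : ℝ) (z : ℂ), A (s * z) = s * A z := fun s z => by
    rw [← Complex.real_smul, map_smul, Complex.real_smul]
  constructor
  · intro θ θ' h
    have n1 := norm_pos_iff.2 (h0 θ)
    have n2 := norm_pos_iff.2 (h0 θ')
    have h1 : A ((‖A θ'‖ : ℝ) * (θ : ℂ)) = A ((‖A θ‖ : ℝ) * (θ' : ℂ)) := by
      rw [hs, hs, ← norm_mul_dir (A θ), ← norm_mul_dir (A θ')]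
      simp only at h
      rw [h]
      simp only [norm_mul, Circle.norm_coe, Complex.norm_real, norm_norm, mul_one]
      ring
    have h2 := congrArg dir (hA h1)
    rwa [dir_mul n2, dir_mul n1] at h2
  · intro w
    obtain ⟨z, hz⟩ := (LinearMap.injective_iff_surjective.1 hA) w
    have hz0 : z ≠ 0 := by
      rintro rfl
      exact w.coe_ne_zero (by rw [← hz, map_zero])
    refine ⟨dir z, ?_⟩
    have h1 := hs ‖z‖ (dir z)
    rw [norm_mul_dir, hz] at h1
    have h2 := congrArg dir h1
    rw [dir_smul (norm_pos_iff.2 hz0)] at h2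
    simp only [← h2]
    simpa using dir_mul one_pos w

/-- A family of injective real-linear maps on the fibres of the torus, whose value at `1` has a
continuous argument, is isotopic to the identity or the reflection on the fibres. -/
theorem exists_linear_isotopy (l : Circle → ℂ →L[ℝ] ℂ) (hl : ∀ v, Function.Injective (l v))
    (hl1 : Continuous fun v => l v 1) (hlI : Continuous fun v => l v Complex.I)
    {c : Circle → Circle} (hc : Continuous c) (hcbij : Function.Bijective c)
    (σ : C(Circle, ℝ)) (hσ : ∀ v, Circle.exp (σ v) = dir (l v 1)) :
    ∃ B : unitInterval × (Circle × Circle) → Circle × Circle, Continuous B ∧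
      (∀ t, Function.Bijective fun y => B (t, y)) ∧
      (∀ θ v : Circle, B (1, (θ, v)) = (dir (l v θ), c v)) ∧
      ∃ κ : Circle → Circle, ∀ θ v, B (0, (θ, v)) = (κ θ, c v) := by
  have hlin : ∀ v (z : ℂ), l v z = z.re * l v 1 + z.im * l v Complex.I := by
    intro v z
    conv_lhs => rw [← Complex.re_add_im z]
    rw [map_add, show ((z.re : ℝ) : ℂ) = z.re • (1 : ℂ) by simp,
      show ((z.im : ℝ) : ℂ) * Complex.I = z.im • Complex.I by simp, map_smul, map_smul]
    simp
  -- Rotation by `-σ v` makes the image of `1` real and positive, so the linear map becomes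
  -- triangular.
  let rot : Circle → ℂ := fun v => (Circle.exp (-σ v) : Circle)
  have hrot : Continuous rot := by
    have := σ.continuous
    fun_prop
  have hrot1 : ∀ v, rot v * l v 1 = ‖l v 1‖ := by
    intro v
    conv_lhs => rw [← norm_mul_dir (l v 1), ← hσ v]
    simp only [rot, Circle.exp_neg, mul_left_comm, ← Circle.coe_mul, inv_mul_cancel]
    simp
  have hM : ∀ v, 0 < ‖l v 1‖ := fun v =>
    norm_pos_iff.2 fun h => one_ne_zero (hl v (h.trans (map_zero _).symm))
  let x : Circle → ℂ := fun v => rot v * l v Complex.I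
  have hx : Continuous x := hrot.mul hlI
  have hx0 : ∀ v, (x v).im ≠ 0 := by
    intro v h
    have h1 : x v = ((x v).re : ℂ) := by
      apply Complex.ext <;> simp [h]
    have h2 : rot v * l v (((x v).re : ℂ) - (‖l v 1‖ : ℂ) * Complex.I) = 0 := by
      rw [hlin, mul_add, mul_left_comm, hrot1, mul_left_comm]
      change _ + _ * x v = 0
      rw [h1]
      simp
      ring
    have h3 := (mul_eq_zero.1 h2).resolve_left (Circle.coe_ne_zero _)
    have h4 := congrArg Complex.im (hl v (h3.trans (map_zero _).symm))
    simp at h4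
    exact (hM v).ne' (norm_eq_zero.2 h4)
  -- The second diagonal entry never vanishes and the circle is connected, so its sign `ε` is
  -- constant; it decides between identity and reflection.
  obtain ⟨ε, hε⟩ : ∃ ε : ℝ, ∀ v, 0 < ε * (x v).im := by
    have hxi : Continuous fun v => (x v).im := Complex.continuous_im.comp hx
    by_cases h : 0 < (x 1).im
    · refine ⟨1, fun v => ?_⟩
      rw [one_mul]
      by_contra hv
      obtain ⟨w, hw⟩ := mem_range_of_exists_le_of_exists_ge hxi ⟨v, not_lt.1 hv⟩ ⟨1, h.le⟩
      exact hx0 w hw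
    · refine ⟨-1, fun v => ?_⟩
      by_contra hv
      obtain ⟨w, hw⟩ := mem_range_of_exists_le_of_exists_ge hxi ⟨1, not_lt.1 h⟩
        ⟨v, by linarith [not_lt.1 hv]⟩
      exact hx0 w hw
  -- The segment of triangular matrices from the diagonal matrix with entries `1`, `ε` to the
  -- rotated map; the signs on the diagonal persist, so every matrix is invertible.
  let N : ℝ → Circle → ℂ → ℂ := fun t v z =>
    (z.re * (t * ‖l v 1‖ + (1 - t)) : ℝ) + z.im * (t * x v + (1 - t) * ε * Complex.I)
  have hNre : ∀ t v z, (N t v z).re = z.re * (t * ‖l v 1‖ + (1 - t)) + z.im * (t * (x v).re) := by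
    intro t v z
    simp [N]
  have hNim : ∀ t v z, (N t v z).im = z.im * (t * (x v).im + (1 - t) * ε) := by
    intro t v z
    simp [N]
  have hN0 : ∀ t ∈ unitInterval, ∀ v z, N t v z = 0 → z = 0 := by
    intro t ht v z h
    have hε0 : ε ≠ 0 := fun h => by simpa [h] using hε 1
    have h1 : t * (x v).im + (1 - t) * ε ≠ 0 := by
      intro h2
      have h3 : t * (ε * (x v).im) + (1 - t) * ε ^ 2 = 0 := by linear_combination ε * h2
      have h4 : 0 < ε ^ 2 := by positivity
      rcases eq_or_lt_of_le ht.1 with h5 | h5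
      · rw [← h5] at h3; linarith
      · have := mul_pos h5 (hε v)
        have := mul_nonneg (sub_nonneg.2 ht.2) h4.le
        linarith
    have him : z.im = 0 := by
      have := congrArg Complex.im h
      rw [hNim] at this
      exact (mul_eq_zero.1 this).resolve_right h1
    have hre : z.re = 0 := by
      have := congrArg Complex.re h
      rw [hNre, him, zero_mul, add_zero] at this
      refine (mul_eq_zero.1 this).resolve_right (ne_of_gt ?_)
      rcases eq_or_lt_of_le ht.1 with h5 | h5
      · rw [← h5]; simp
      · have := mul_pos h5 (hM v)
        linarith [ht.2]
    exact Complex.ext hre him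
  let A : ℝ → Circle → ℂ →ₗ[ℝ] ℂ := fun t v =>
    { toFun := N t v
      map_add' := fun z w => by simp only [N, Complex.add_re, Complex.add_im]; push_cast; ring
      map_smul' := fun s z => by
        simp only [N, Complex.real_smul, Complex.re_ofReal_mul, Complex.im_ofReal_mul,
          RingHom.id_apply]
        push_cast; ring }
  have hA : ∀ t ∈ unitInterval, ∀ v, Function.Injective (A t v) := fun t ht v =>
    (injective_iff_map_eq_zero (A t v)).2 (hN0 t ht v)
  have hNc : Continuous fun y : unitInterval × (Circle × Circle) =>
      N y.1 y.2.2 (y.2.1 : Circle) := by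
    have h1 := hl1.norm
    have h2 : Continuous fun θ : Circle => (θ : ℂ).re :=
      Complex.continuous_re.comp continuous_subtype_val
    have h3 : Continuous fun θ : Circle => (θ : ℂ).im :=
      Complex.continuous_im.comp continuous_subtype_val
    simp only [N]
    fun_prop
  -- The continuous argument is needed here: the rotation by `t * σ v` undoes `rot` at time one and
  -- is trivial at time zero.
  refine ⟨fun y => (Circle.exp (y.1 * σ y.2.2) * dir (N y.1 y.2.2 (y.2.1 : Circle)), c y.2.2),
    ?_, ?_, ?_, fun θ => dir (N 0 1 θ), ?_⟩
  · have h1 := hNc.circleDir fun y h => (Circle.coe_ne_zero _) (hN0 _ y.1.2 _ _ h)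
    have h2 := σ.continuous
    fun_prop
  · intro t
    have hb : ∀ v, Function.Bijective fun θ : Circle =>
        Circle.exp (t * σ v) * dir (N t v θ) := fun v =>
      (Group.mulLeft_bijective _).comp (bijective_dir_linear (A t v) (hA t t.2 v))
    constructor
    · rintro ⟨θ, v⟩ ⟨θ', v'⟩ h
      simp only [Prod.mk.injEq] at h
      obtain rfl := hcbij.1 h.2
      rw [(hb v).1 h.1]
    · rintro ⟨α, w⟩
      obtain ⟨v, rfl⟩ := hcbij.2 w
      obtain ⟨θ, rfl⟩ := (hb v).2 α
      exact ⟨(θ, v), rfl⟩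
  · intro θ v
    have h1 : N 1 v θ = rot v * l v θ := by
      rw [hlin, mul_add, mul_left_comm, hrot1, mul_left_comm]
      simp [N, x]
    have h2 : l v θ ≠ 0 := fun h => θ.coe_ne_zero (hl v (h.trans (map_zero _).symm))
    simp only [Set.Icc.coe_one, h1, Prod.mk.injEq, and_true, one_mul]
    rw [← norm_mul_dir (l v θ), mul_left_comm, ← Circle.coe_mul, dir_mul (norm_pos_iff.2 h2),
      dir_mul (norm_pos_iff.2 h2), ← mul_assoc, ← Circle.exp_add]
    simp
  · intro θ v
    simp [N]

/-! ### Surgery on a Hopf link is realized by the swap -/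

namespace TubeSystem

variable {ι : Type} {K : ι → Set S3} (T : TubeSystem K)

/-- The place where tubes with a preferred framing meet the abstract extension. The second angle
along the core is a homeomorphism because the core parametrizes the component; the first angle is
straightened by means of the longitude. -/
theorem exists_extension {n : ℕ} (hn : 2 ≤ n) (k : ℕ) (H : HopfFrame) (hHa : H.a = chainFun n k)
    {j j' : ι} (hj : K j = {x | H.a x = 0}) (hj' : K j' = {x | H.b x = 0}) (hne : j ≠ j')
    {g : unitInterval × (Circle × Circle) → Circle × Circle} (hg : Continuous g)
    (hgbij : ∀ t, Function.Bijective fun y => g (t, y))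
    {χ₁ χ₂ : Circle → Circle} (hg0 : ∀ α β, g (0, (α, β)) = (χ₁ β, χ₂ α)) :
    ∃ G : Disk × Circle → S3, Continuous G ∧ Function.Injective G ∧
      (∀ u v, G (diskBoundary u, v) = H.torusMap (fun y => g (1, y)) (T.tube j (v, u))) ∧
      Set.range G = H.torusMap (fun y => g (1, y)) '' T.closedTube j ∧
      Set.range (fun v => G (diskCentre, v)) = K j := by
  obtain ⟨P, hP, hP0, haP, l, hl, hPl⟩ := T.exists_blowup hn k j (by rw [hj, hHa])
  have hb : ∀ u v, ‖u‖ ≤ 1 → H.b (T.tube j (u, v)) ≠ 0 := by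
    intro u v hu h
    have h1 : T.tube j (u, v) ∈ K j' := by rw [hj']; exact h
    exact Set.disjoint_left.1 (T.disjoint_closedTube hne)
      ⟨(u, v), ⟨mem_closedBall_zero_iff.2 hu, trivial⟩, rfl⟩ (T.core_subset_closedTube j' h1)
  have ha0 : ∀ v, H.a (T.tube j (0, v)) = 0 := by
    intro v
    have h1 : T.tube j (0, v) ∈ K j := by rw [← T.core j]; exact ⟨v, rfl⟩
    rwa [hj] at h1
  have hb0 : ∀ v, H.b (T.tube j (0, v)) ≠ 0 := fun v => hb 0 v (by simp)
  have hl1 : Continuous fun v => l v 1 := by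
    have : Continuous fun v => P (0, (1, v)) := by fun_prop
    refine this.congr fun v => ?_
    rw [hPl]; simp
  have hlI : Continuous fun v => l v Complex.I := by
    have : Continuous fun v => P (0, (⟨Complex.I, by simp [Submonoid.unitSphere]⟩, v)) := by
      fun_prop
    exact this.congr fun v => hPl _ v
  -- the argument of the first coordinate along the longitude
  obtain ⟨σ, hσ⟩ : ∃ σ : C(Circle, ℝ), ∀ v, Circle.exp (σ v) = dir (l v 1) := by
    have hmem : ∀ v, T.tube j (1, v) ∈ (K j)ᶜ := by
      intro v h
      rw [← T.core j] at h
      obtain ⟨w, hw⟩ := h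
      exact zero_ne_one (Prod.mk.inj (T.injective j hw)).1
    obtain ⟨σ₁, hσ₁⟩ := (T.preferred j).exists_arg
      ⟨fun x => dir (H.a x), (H.continuous_a.comp continuous_subtype_val).circleDir fun x h =>
        x.2 ((Set.ext_iff.1 hj _).2 h)⟩ hmem
    have hPd := hP.circleDir hP0
    -- At radius one `P` is the first coordinate on the longitude, and at radius zero it is `l v 1`.
    -- As `P` never vanishes, shrinking the radius is a homotopy; time is reversed so that it starts
    -- at the longitude.
    obtain ⟨σ₀, hσ₀⟩ := exists_arg_of_homotopy
      ⟨fun y => dir (P (unitInterval.symm y.1, (1, y.2))), hPd.comp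
        ((unitInterval.continuous_symm.comp continuous_fst).prodMk
          (continuous_const.prodMk continuous_snd))⟩ σ₁ (by
        intro v
        rw [hσ₁]
        have := haP 1 1 v
        simp only [Set.Icc.coe_one, Complex.ofReal_one, Circle.coe_one, one_mul] at this
        simp only [ContinuousMap.coe_mk, hHa, this, unitInterval.symm_zero])
    refine ⟨σ₀, fun v => ?_⟩
    rw [hσ₀]
    simp [hPl]
  have hc : Continuous fun v => dir (H.b (T.tube j (0, v))) :=
    (H.continuous_b.comp ((T.continuous_tube j).comp (by fun_prop))).circleDir hb0
  have hcinv : ∀ v, H.inv (0, dir (H.b (T.tube j (0, v)))) = T.tube j (0, v) := fun v =>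
    H.inv_scale _ _ (norm_pos_iff.2 (hb0 v)) _ _ (by simp [ha0]) (norm_mul_dir _).symm
  have hcbij : Function.Bijective fun v => dir (H.b (T.tube j (0, v))) := by
    constructor
    · intro v w h
      have h1 := hcinv v
      simp only at h
      rw [h, hcinv w] at h1
      exact (Prod.mk.inj (T.injective j h1)).2.symm
    · intro w
      have h1 : H.inv (0, w) ∈ K j := by
        rw [hj]; exact H.a_inv_eq_zero w.coe_ne_zero
      rw [← T.core j] at h1
      obtain ⟨v, hv⟩ := h1
      exact ⟨v, H.inv_circle_injective ((hcinv v).trans hv)⟩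
  obtain ⟨B, hB, hBbij, hB1, κ, hB0⟩ := exists_linear_isotopy l hl hl1 hlI hc hcbij σ hσ
  have := H.exists_extension (T.continuous_tube j) (T.injective j) ((T.core j).trans hj) hb hP hP0
    (fun r θ v => by rw [hHa]; exact haP r θ v) hB hBbij
    (fun θ v => by rw [hB1, hPl]) hB0 hg hgbij hg0
  rwa [← hj] at this

/-- The second component is treated in the exchanged frame, with the torus isotopy conjugated by the
exchange of factors; the quarter turn again interchanges the two factors. -/
theorem realizes_torusSwap {n : ℕ} (hn : 2 ≤ n) (k k' : ℕ) (H : HopfFrame)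
    (hHa : H.a = chainFun n k) (hHb : H.b = chainFun n k') {j j' : ι}
    (hj : K j = {x | H.a x = 0}) (hj' : K j' = {x | H.b x = 0}) (hne : j ≠ j') :
    T.Realizes {j, j'} (H.torusMap (torusSwap 1)) := by
  have hg : Continuous fun y : unitInterval × (Circle × Circle) => torusSwap y.1 y.2 := by
    have h : Continuous fun y : unitInterval × (Circle × Circle) => ((y.1 : ℝ), y.2) := by fun_prop
    simpa only [Function.comp_def] using continuous_torusSwap.comp h
  have hg1 : Continuous (torusSwap 1) := by
    have h : Continuous fun y : Circle × Circle => ((1 : ℝ), y) := by fun_prop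
    simpa only [Function.comp_def] using continuous_torusSwap.comp h
  refine ⟨HopfFrame.bijective_torusMap (bijective_torusSwap 1), ?_, ?_, ?_⟩
  · refine (HopfFrame.continuousOn_torusMap hg1).mono ?_
    intro x hx
    simp only [Set.mem_compl_iff, Set.mem_iUnion, not_exists] at hx
    refine ⟨fun h => hx j (by simp) ?_, fun h => hx j' (by simp) ?_⟩
    · rw [hj]; exact h
    · rw [hj']; exact h
  · have key : ∀ i ∈ ({j, j'} : Set ι), ∀ x ∈ K i, H.torusMap (torusSwap 1) x = x := by
      rintro i (rfl | rfl) x hx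
      · rw [hj] at hx
        exact HopfFrame.torusMap_of_zero (Or.inl hx)
      · rw [hj'] at hx
        exact HopfFrame.torusMap_of_zero (Or.inr hx)
    intro i hi
    rw [Set.image_congr (key i hi), Set.image_id']
  · rintro i (rfl | rfl)
    · have := T.exists_extension hn k H hHa hj hj' hne hg
        (fun t => bijective_torusSwap t) (χ₁ := fun β => β⁻¹) (χ₂ := id)
        (fun α β => torusSwap_zero _)
      simpa only [Set.Icc.coe_one] using this
    · let g : unitInterval × (Circle × Circle) → Circle × Circle := fun y =>
        (torusSwap y.1 y.2.swap).swap
      have hg' : Continuous g := continuous_swap.comp (hg.comp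
        (continuous_fst.prodMk (continuous_swap.comp continuous_snd)))
      have hgbij : ∀ t, Function.Bijective fun y => g (t, y) := fun t =>
        Prod.swap_bijective.comp ((bijective_torusSwap t).comp Prod.swap_bijective)
      have hg0 : ∀ α β, g (0, (α, β)) = (id β, α⁻¹) := fun α β => by
        simp only [g, Set.Icc.coe_zero, torusSwap_zero]
        rfl
      have := T.exists_extension hn k' H.swap hHb hj' hj hne.symm hg' hgbij hg0
      have e : H.swap.torusMap (fun y => g (1, y)) =
          H.torusMap (torusSwap 1) :=
        funext (HopfFrame.torusMap_swap (torusSwap 1))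
      rwa [e] at this

end TubeSystem

/-- For the last index `i.val + 1` is `2 * n` instead of `0`; the zero sets still agree. -/
theorem chainLink_add_one {n : ℕ} (hn : 2 ≤ n) (i : ZMod (2 * n)) :
    chainLink n (i + 1) = {x | chainFun n (i.val + 1) x = 0} := by
  have : NeZero (2 * n) := ⟨by omega⟩
  have h : ((i.val + 1 : ℕ) : ZMod (2 * n)) = i + 1 := by simp
  rw [← h, chainLink_natCast hn]

theorem realizes_mlSwap {n : ℕ} (hn : 2 ≤ n) (i : ZMod (2 * n)) (T : TubeSystem (chainLink n)) :
    T.Realizes {i, i + 1} (mlSwap n i) := by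
  have hne : i ≠ i + 1 := by
    have : Fact (1 < 2 * n) := ⟨by omega⟩
    simp
  rw [mlSwap_eq hn]
  exact T.realizes_torusSwap hn i.val (i.val + 1) (chainFrame hn i.val) rfl rfl rfl
    (chainLink_add_one hn i) hne

/-! ### Supports of swaps; non-overlapping swaps -/

/-- The points at which the `k`-th function of the chain has nonnegative real part lie over an arc
of the axis with centre `k` and radius `3/4`, in units of `π / n`. -/
theorem exists_near {n : ℕ} (hn : 2 ≤ n) (k : ℕ) {x : S3} (hx : 0 ≤ (chainFun n k x).re) :
    ∃ m : ℤ, |Complex.arg ((x : C2) 0) * n / Real.pi - k - 2 * n * m| ≤ 3 / 4 := by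
  have hn0 : (0 : ℝ) < n := by exact_mod_cast (by omega : 0 < n)
  have hn2 : (2 : ℝ) ≤ n := by exact_mod_cast hn
  have hpi := Real.pi_pos
  set z := (x : C2) 0
  set ρ := 3 * Real.pi / (4 * n) with hρ
  have hρ0 : 0 ≤ ρ := by positivity
  have hρ2 : ρ < Real.pi / 2 := by
    rw [hρ, div_lt_div_iff₀ (by positivity) (by positivity)]
    nlinarith
  have hcos : 0 < Real.cos ρ := Real.cos_pos_of_mem_Ioo ⟨by linarith, hρ2⟩
  set φ := Complex.arg z - k * Real.pi / n with hφ
  have hre : (z * Complex.exp (-(k * Real.pi / n * Complex.I))).re = ‖z‖ * Real.cos φ := by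
    have h1 : z * Complex.exp (-(k * Real.pi / n * Complex.I)) =
        (‖z‖ : ℂ) * Complex.exp ((φ : ℝ) * Complex.I) := by
      conv_lhs => rw [← Complex.norm_mul_exp_arg_mul_I z]
      rw [mul_assoc, ← Complex.exp_add]
      congr 2
      rw [hφ]; push_cast; ring
    rw [h1, Complex.re_ofReal_mul, Complex.exp_ofReal_mul_I_re]
  have hz : ‖z‖ ≤ 1 := by
    have h1 : ‖(x : C2)‖ ^ 2 = 1 := by rw [mem_sphere_zero_iff_norm.1 x.2, one_pow]
    rw [EuclideanSpace.norm_sq_eq, Fin.sum_univ_two] at h1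
    nlinarith [norm_nonneg z, sq_nonneg ‖(x : C2) 1‖]
  -- The real part is `‖z‖ * cos φ - cos ρ` with `‖z‖ ≤ 1`, and `cos ρ > 0` makes `cos φ` positive.
  have hge : Real.cos ρ ≤ Real.cos φ := by
    have h1 : Real.cos ρ ≤ ‖z‖ * Real.cos φ := by
      rw [← hre]
      have h2 : (chainFun n k x).re =
        (z * Complex.exp (-(k * Real.pi / n * Complex.I))).re - Real.cos ρ := rfl
      linarith
    have h3 : 0 < Real.cos φ := by
      by_contra h
      have := mul_nonpos_of_nonneg_of_nonpos (norm_nonneg z) (not_lt.1 h)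
      linarith
    nlinarith
  refine ⟨round (φ / (2 * Real.pi)), ?_⟩
  set m := round (φ / (2 * Real.pi))
  have hm : |φ - m * (2 * Real.pi)| ≤ Real.pi := by
    have h1 := abs_sub_round (φ / (2 * Real.pi))
    have h2 : φ - m * (2 * Real.pi) = (φ / (2 * Real.pi) - m) * (2 * Real.pi) := by field_simp
    rw [h2, abs_mul, abs_of_pos (by positivity : 0 < 2 * Real.pi)]
    nlinarith
  have hle : |φ - m * (2 * Real.pi)| ≤ ρ := by
    by_contra h
    have h1 := Real.cos_lt_cos_of_nonneg_of_le_pi hρ0 hm (not_le.1 h)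
    rw [Real.cos_abs, Real.cos_sub_int_mul_two_pi] at h1
    linarith
  have he : Complex.arg z * n / Real.pi - k - 2 * n * m =
      (φ - m * (2 * Real.pi)) * (n / Real.pi) := by
    rw [hφ]; field_simp
  rw [he, abs_mul, abs_of_pos (by positivity : 0 < (n : ℝ) / Real.pi)]
  calc _ ≤ ρ * (n / Real.pi) := by gcongr
    _ = 3 / 4 := by rw [hρ]; field_simp

/-- Two functions of the chain with nonnegative real parts at the same point have indices that
differ by at most one. -/
theorem exists_int_of_re_nonneg {n : ℕ} (hn : 2 ≤ n) {k k' : ℕ} {x : S3}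
    (hx : 0 ≤ (chainFun n k x).re) (hx' : 0 ≤ (chainFun n k' x).re) :
    ∃ N : ℤ, |N| ≤ 1 ∧ (k : ZMod (2 * n)) = k' + N := by
  obtain ⟨m, hm⟩ := exists_near hn k hx
  obtain ⟨m', hm'⟩ := exists_near hn k' hx'
  refine ⟨k - k' + 2 * n * (m - m'), ?_, ?_⟩
  -- Two arcs of radius `3/4` meet only if their centres are at distance at most `3/2`.
  · have h1 : |((k - k' + 2 * n * (m - m') : ℤ) : ℝ)| < 2 := by
      push_cast
      rw [abs_le] at hm hm'
      rw [abs_lt]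
      constructor <;> linarith
    have h2 : |(k - k' + 2 * n * (m - m') : ℤ)| < 2 := by exact_mod_cast h1
    omega
  · have h3 : ((2 * n : ℕ) : ZMod (2 * n)) = 0 := ZMod.natCast_self _
    push_cast at h3 ⊢
    rw [h3]
    ring

/-- At a common point the indices `k` and `k'` would differ by at most one, and each differs from
its swap index by at most one. Then `i - j` would have a representative below `4` in absolute value.
-/
theorem NonOverlapping.not_re_nonneg {n : ℕ} (hn : 2 ≤ n) {i j : ZMod (2 * n)}
    (h : NonOverlapping n i j) {k k' : ℕ} (hk : k = i.val ∨ k = i.val + 1)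
    (hk' : k' = j.val ∨ k' = j.val + 1) {x : S3} (hx : 0 ≤ (chainFun n k x).re) :
    (chainFun n k' x).re < 0 := by
  by_contra hx'
  have : NeZero (2 * n) := ⟨by omega⟩
  obtain ⟨N, hN, he⟩ := exists_int_of_re_nonneg hn hx (not_lt.1 hx')
  have key : ∃ M : ℤ, |M| ≤ 3 ∧ i - j = (M : ZMod (2 * n)) := by
    rw [abs_le] at hN
    rcases hk with rfl | rfl <;> rcases hk' with rfl | rfl <;> push_cast at he <;>
      simp only [ZMod.natCast_val, ZMod.cast_id', id] at he
    · exact ⟨N, abs_le.2 ⟨by omega, by omega⟩, by rw [he]; ring⟩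
    · exact ⟨N + 1, abs_le.2 ⟨by omega, by omega⟩, by rw [he]; push_cast; ring⟩
    · exact ⟨N - 1, abs_le.2 ⟨by omega, by omega⟩, by
        rw [eq_sub_of_add_eq he]; push_cast; ring⟩
    · exact ⟨N, abs_le.2 ⟨by omega, by omega⟩, by
        rw [eq_sub_of_add_eq he]; ring⟩
  obtain ⟨M, hM, hMe⟩ := key
  -- `valMinAbs` has the least absolute value among all representatives, in particular at most that
  -- of `M`.
  have h1 := ZMod.natAbs_min_of_le_div_two (2 * n) (i - j).valMinAbs M
    (by rw [ZMod.coe_valMinAbs, hMe]) (ZMod.natAbs_valMinAbs_le _)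
  have h2 : 4 ≤ (i - j).valMinAbs.natAbs := h
  rw [abs_le] at hM
  omega

theorem NonOverlapping.mlSwap_of_re_nonneg {n : ℕ} (hn : 2 ≤ n) {i j : ZMod (2 * n)}
    (h : NonOverlapping n i j) {x : S3} :
    (∀ k, (k = j.val ∨ k = j.val + 1) → 0 ≤ (chainFun n k x).re → mlSwap n i x = x) ∧
    (∀ k, (k = i.val ∨ k = i.val + 1) → 0 ≤ (chainFun n k x).re → mlSwap n j x = x) := by
  constructor
  · intro k hk hx
    refine mlSwap_of_re_nonpos hn i ?_ ?_
    · by_contra hc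
      exact (h.not_re_nonneg hn (Or.inl rfl) hk (not_le.1 hc).le).not_ge hx
    · by_contra hc
      exact (h.not_re_nonneg hn (Or.inr rfl) hk (not_le.1 hc).le).not_ge hx
  · intro k hk hx
    exact mlSwap_of_re_nonpos hn j (h.not_re_nonneg hn hk (Or.inl rfl) hx).le
      (h.not_re_nonneg hn hk (Or.inr rfl) hx).le

theorem exists_re_pos_of_mlSwap_ne {n : ℕ} (hn : 2 ≤ n) {i : ZMod (2 * n)} {x : S3}
    (h : mlSwap n i x ≠ x) : ∃ k, (k = i.val ∨ k = i.val + 1) ∧ 0 ≤ (chainFun n k x).re := by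
  by_contra! hc
  exact h (mlSwap_of_re_nonpos hn i (hc _ (Or.inl rfl)).le (hc _ (Or.inr rfl)).le)

/-- Non-overlapping `ml`-swaps commute. -/
theorem NonOverlapping.commute {n : ℕ} (hn : 2 ≤ n) {i j : ZMod (2 * n)}
    (h : NonOverlapping n i j) (x : S3) :
    mlSwap n i (mlSwap n j x) = mlSwap n j (mlSwap n i x) := by
  have hi := (bijective_mlSwap hn i).1
  have hj := (bijective_mlSwap hn j).1
  by_cases h1 : mlSwap n i x = x
  · by_cases h2 : mlSwap n j x = x
    · rw [h1, h2, h1]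
    · rw [h1]
      -- By injectivity the image of a moved point is moved too. It therefore lies in the support of
      -- the same swap, where the other swap is the identity.
      obtain ⟨k, hk, hx⟩ := exists_re_pos_of_mlSwap_ne hn (i := j)
        (x := mlSwap n j x) (fun he => h2 (hj he))
      exact (h.mlSwap_of_re_nonneg hn).1 k hk hx
  · obtain ⟨k, hk, hx⟩ := exists_re_pos_of_mlSwap_ne hn h1
    rw [(h.mlSwap_of_re_nonneg hn).2 k hk hx]
    obtain ⟨k, hk, hx⟩ := exists_re_pos_of_mlSwap_ne hn (i := i)
      (x := mlSwap n i x) (fun he => h1 (hi he))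
    exact ((h.mlSwap_of_re_nonneg hn).2 k hk hx).symm

theorem exists_chainFun_eq_zero {n : ℕ} (hn : 2 ≤ n) {j k : ZMod (2 * n)} (hk : k = j ∨ k = j + 1)
    {x : S3} (hx : x ∈ chainLink n k) :
    ∃ l, (l = j.val ∨ l = j.val + 1) ∧ 0 ≤ (chainFun n l x).re := by
  rcases hk with rfl | rfl
  · exact ⟨_, Or.inl rfl, by rw [show chainFun n k.val x = 0 from hx]; simp⟩
  · rw [chainLink_add_one hn] at hx
    exact ⟨_, Or.inr rfl, by rw [show chainFun n (j.val + 1) x = 0 from hx]; simp⟩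

/-- An `ml`-swap fixes the components of the Hopf link of a non-overlapping one. -/
theorem NonOverlapping.mlSwap_of_mem {n : ℕ} (hn : 2 ≤ n) {i j k : ZMod (2 * n)}
    (h : NonOverlapping n i j) {x : S3} (hx : x ∈ chainLink n k) :
    ((k = j ∨ k = j + 1) → mlSwap n i x = x) ∧ ((k = i ∨ k = i + 1) → mlSwap n j x = x) := by
  constructor <;> intro hk <;> obtain ⟨l, hl, h0⟩ := exists_chainFun_eq_zero hn hk hx
  · exact (h.mlSwap_of_re_nonneg hn).1 l hl h0
  · exact (h.mlSwap_of_re_nonneg hn).2 l hl h0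

theorem mlSwaps_cons (n : ℕ) (i : ZMod (2 * n)) (l : List (ZMod (2 * n))) :
    mlSwaps n (i :: l) = mlSwap n i ∘ mlSwaps n l := rfl

theorem mlSwaps_of_forall {n : ℕ} {l : List (ZMod (2 * n))} {x : S3}
    (h : ∀ j ∈ l, mlSwap n j x = x) : mlSwaps n l x = x := by
  induction l with
  | nil => rfl
  | cons j l ih =>
    rw [mlSwaps_cons, Function.comp_apply, ih fun j hj => h j (List.mem_cons_of_mem _ hj)]
    exact h j List.mem_cons_self

theorem mlSwap_mlSwaps_comm {n : ℕ} (hn : 2 ≤ n) {i : ZMod (2 * n)} {l : List (ZMod (2 * n))}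
    (h : ∀ j ∈ l, NonOverlapping n i j) (x : S3) :
    mlSwap n i (mlSwaps n l x) = mlSwaps n l (mlSwap n i x) := by
  induction l with
  | nil => rfl
  | cons j l ih =>
    simp only [mlSwaps_cons, Function.comp_apply]
    rw [(h j List.mem_cons_self).commute hn, ih fun j hj => h j (List.mem_cons_of_mem _ hj)]

theorem hopfSublink_cons (n : ℕ) (i : ZMod (2 * n)) (l : List (ZMod (2 * n))) :
    hopfSublink n (i :: l) = {i, i + 1} ∪ hopfSublink n l := by
  ext k
  simp [hopfSublink]

/-- Induction by `Realizes.comp`. Every component of a Hopf sublink lies in the closed support of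
its swap, so disjoint supports give disjoint sublinks and components fixed by the other swaps. -/
theorem realizes_mlSwaps {n : ℕ} (hn : 2 ≤ n) (T : TubeSystem (chainLink n))
    {l : List (ZMod (2 * n))} (hl : l.Pairwise (NonOverlapping n)) :
    T.Realizes (hopfSublink n l) (mlSwaps n l) := by
  induction l with
  | nil =>
    have h : hopfSublink n [] = ∅ := by ext k; simp [hopfSublink]
    rw [h]
    exact ⟨Function.bijective_id, continuous_id.continuousOn, by simp, by simp⟩
  | cons i l ih =>
    rw [List.pairwise_cons] at hl
    rw [hopfSublink_cons, mlSwaps_cons]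
    refine (realizes_mlSwap hn i T).comp (ih hl.2) ?_ (mlSwap_mlSwaps_comm hn hl.1) ?_ ?_
    · rw [Set.disjoint_left]
      rintro k hk ⟨j, hj, hkj⟩
      have hx : T.tube k (0, 1) ∈ chainLink n k := by
        rw [← T.core k]; exact ⟨1, rfl⟩
      obtain ⟨a, ha, ha'⟩ := exists_chainFun_eq_zero hn (j := i) hk hx
      obtain ⟨b, hb, hb'⟩ := exists_chainFun_eq_zero hn hkj hx
      exact ((hl.1 j hj).not_re_nonneg hn ha hb ha').not_ge hb'
    · rintro k ⟨j, hj, hkj⟩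
      rw [Set.image_congr fun x hx => ((hl.1 j hj).mlSwap_of_mem hn hx).1 hkj, Set.image_id']
    · intro k hk
      rw [Set.image_congr fun x hx => mlSwaps_of_forall fun j hj =>
        ((hl.1 j hj).mlSwap_of_mem hn hx).2 hk, Set.image_id']

/-- Different components of the chain are disjoint. -/
theorem disjoint_chainLink {n : ℕ} (hn : 2 ≤ n) {j k : ZMod (2 * n)} (h : j ≠ k) :
    Disjoint (chainLink n j) (chainLink n k) := by
  have : NeZero (2 * n) := ⟨by omega⟩
  have hadj : ∀ (i : ZMod (2 * n)) (x : S3), x ∈ chainLink n i → x ∉ chainLink n (i + 1) := by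
    intro i x h1 h2
    rw [chainLink_add_one hn] at h2
    exact (chainFun_ne_zero hn i.val x).elim (fun h => h h1) fun h => h h2
  rw [Set.disjoint_left]
  intro x hj hk
  have h0 : ∀ i : ZMod (2 * n), x ∈ chainLink n i → 0 ≤ (chainFun n i.val x).re := fun i hi => by
    rw [show chainFun n i.val x = 0 from hi]; simp
  obtain ⟨N, hN, he⟩ := exists_int_of_re_nonneg hn (h0 j hj) (h0 k hk)
  simp only [ZMod.natCast_val, ZMod.cast_id', id] at he
  rw [abs_le] at hN
  obtain rfl | rfl | rfl : N = -1 ∨ N = 0 ∨ N = 1 := by omega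
  · have : k = j + 1 := by rw [he]; push_cast; ring
    rw [this] at hk
    exact hadj j x hj hk
  · exact h (by simpa using he)
  · have : j = k + 1 := by rw [he]; push_cast; ring
    rw [this] at hj
    exact hadj k x hk hj

/-! ### Explicit tubes around the components of the chain -/

/-- The cosine of the angular radius of the components. -/
def chainCos (n : ℕ) : ℝ := Real.cos (3 * Real.pi / (4 * n))

/-- The sine of the angular radius of the components. -/
def chainSin (n : ℕ) : ℝ := Real.sqrt (1 - chainCos n ^ 2)

theorem chainSin_pos {n : ℕ} (hn : 2 ≤ n) : 0 < chainSin n :=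
  Real.sqrt_pos.2 (sub_pos.2 (cos_radius_sq_lt_one hn))

theorem chainSin_sq {n : ℕ} (hn : 2 ≤ n) : chainSin n ^ 2 = 1 - chainCos n ^ 2 :=
  Real.sq_sqrt (sub_pos.2 (cos_radius_sq_lt_one hn)).le

/-- The Euclidean norm of a pair of complex numbers. -/
def pairNorm (y : ℂ × ℂ) : ℝ := Real.sqrt (y.1.re ^ 2 + y.1.im ^ 2 + (y.2.re ^ 2 + y.2.im ^ 2))

theorem pairNorm_arg_pos {y : ℂ × ℂ} (hy : y ≠ 0) :
    0 < y.1.re ^ 2 + y.1.im ^ 2 + (y.2.re ^ 2 + y.2.im ^ 2) := by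
  by_contra h
  have h1 := sq_nonneg y.1.re
  have h2 := sq_nonneg y.1.im
  have h3 := sq_nonneg y.2.re
  have h4 := sq_nonneg y.2.im
  refine hy (Prod.ext (Complex.ext ?_ ?_) (Complex.ext ?_ ?_)) <;>
    simp only [Prod.fst_zero, Prod.snd_zero, Complex.zero_re, Complex.zero_im] <;> nlinarith

theorem pairNorm_sq (y : ℂ × ℂ) :
    pairNorm y ^ 2 = y.1.re ^ 2 + y.1.im ^ 2 + (y.2.re ^ 2 + y.2.im ^ 2) :=
  Real.sq_sqrt (by positivity)

theorem pairNorm_pos {y : ℂ × ℂ} (hy : y ≠ 0) : 0 < pairNorm y :=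
  Real.sqrt_pos.2 (pairNorm_arg_pos hy)

/-- The denominator of the conformal map `boost`. -/
def boostDen (n : ℕ) (y : ℂ × ℂ) : ℝ := pairNorm y + chainCos n * y.1.re

/-- Here `|chainCos n| < 1` and `|y.1.re| ≤ pairNorm y`. -/
theorem boostDen_pos {n : ℕ} (hn : 2 ≤ n) {y : ℂ × ℂ} (hy : y ≠ 0) : 0 < boostDen n y := by
  have h1 := cos_radius_sq_lt_one hn
  have h2 := pairNorm_pos hy
  have h3 := pairNorm_sq y
  have h4 : (chainCos n * y.1.re) ^ 2 < pairNorm y ^ 2 := by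
    have h5 : chainCos n ^ 2 * y.1.re ^ 2 ≤ y.1.re ^ 2 := by
      have : chainCos n ^ 2 ≤ 1 := h1.le
      nlinarith [sq_nonneg y.1.re]
    by_cases h6 : y.1.re = 0
    · rw [h6, mul_zero, zero_pow two_ne_zero]
      exact pow_pos h2 2
    · have h7 : 0 < y.1.re ^ 2 := by positivity
      have h8 : chainCos n ^ 2 * y.1.re ^ 2 < 1 * y.1.re ^ 2 := mul_lt_mul_of_pos_right h1 h7
      nlinarith [sq_nonneg y.1.im, sq_nonneg y.2.re, sq_nonneg y.2.im]
  have h5 := abs_lt_of_sq_lt_sq h4 h2.le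
  unfold boostDen
  linarith [(abs_lt.1 h5).1]

/-- A map that is constant on rays and whose restriction to the unit sphere of `ℂ²` is a conformal
map of the three-sphere that takes the great circle `{0} × S¹` to the `k`-th component of the
chain. -/
def boost (n k : ℕ) (y : ℂ × ℂ) : C2 :=
  !₂[(((y.1.re + chainCos n * pairNorm y) / boostDen n y : ℝ) +
      (chainSin n * y.2.re / boostDen n y : ℝ) * Complex.I) *
      (Complex.exp (-(k * Real.pi / n * Complex.I)))⁻¹,
    ((chainSin n * y.2.im / boostDen n y : ℝ) +
      (chainSin n * y.1.im / boostDen n y : ℝ) * Complex.I) * (Complex.I ^ k)⁻¹]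

theorem boostDen_zero (n : ℕ) (v : Circle) : boostDen n (0, (v : ℂ)) = 1 := by
  have h5 := pairNorm_sq (0, (v : ℂ))
  have h6 := Complex.normSq_apply (v : ℂ)
  rw [Complex.normSq_eq_norm_sq, Circle.norm_coe] at h6
  have h4 : pairNorm (0, (v : ℂ)) = 1 := by
    refine (pow_eq_one_iff_of_nonneg (Real.sqrt_nonneg _) two_ne_zero).1 (h5.trans ?_)
    simp only [Complex.zero_re, Complex.zero_im]
    linarith
  rw [boostDen, h4]
  simp

theorem boost_zero_mul (n k : ℕ) (y : ℂ × ℂ) :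
    boost n k y 0 * Complex.exp (-(k * Real.pi / n * Complex.I)) =
      ⟨(y.1.re + chainCos n * pairNorm y) / boostDen n y, chainSin n * y.2.re / boostDen n y⟩ := by
  have : Complex.exp (-(k * Real.pi / n * Complex.I)) ≠ 0 := Complex.exp_ne_zero _
  simp only [boost, PiLp.toLp_apply, Matrix.cons_val_zero, inv_mul_cancel_right₀ this]
  apply Complex.ext <;> simp only [Complex.add_re, Complex.add_im, Complex.ofReal_re,
    Complex.ofReal_im, Complex.re_ofReal_mul, Complex.im_ofReal_mul, Complex.I_re, Complex.I_im,
    mul_zero, mul_one, add_zero, zero_add]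

theorem boost_one_mul (n k : ℕ) (y : ℂ × ℂ) :
    boost n k y 1 * Complex.I ^ k =
      ⟨chainSin n * y.2.im / boostDen n y, chainSin n * y.1.im / boostDen n y⟩ := by
  have : (Complex.I ^ k : ℂ) ≠ 0 := pow_ne_zero _ Complex.I_ne_zero
  simp only [boost, PiLp.toLp_apply, Matrix.cons_val_one, Matrix.cons_val_fin_one,
    inv_mul_cancel_right₀ this]
  apply Complex.ext <;> simp only [Complex.add_re, Complex.add_im, Complex.ofReal_re,
    Complex.ofReal_im, Complex.re_ofReal_mul, Complex.im_ofReal_mul, Complex.I_re, Complex.I_im,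
    mul_zero, mul_one, add_zero, zero_add]

/-- With `pairNorm y` as time coordinate, `y` is a light-like vector. A Lorentz boost of velocity
`chainCos n` along `y.1.re` preserves the light cone, and division by the new time gives a unit
vector. -/
theorem norm_boost {n : ℕ} (hn : 2 ≤ n) (k : ℕ) {y : ℂ × ℂ} (hy : y ≠ 0) : ‖boost n k y‖ = 1 := by
  have h1 : ‖boost n k y‖ ^ 2 = 1 := by
    rw [norm_sq_rotate n k, boost_zero_mul, boost_one_mul, ← Complex.normSq_eq_norm_sq,
      ← Complex.normSq_eq_norm_sq, Complex.normSq_mk, Complex.normSq_mk]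
    have h2 := (boostDen_pos hn hy).ne'
    have h3 := pairNorm_sq y
    have h4 := chainSin_sq hn
    field_simp
    unfold boostDen
    linear_combination (y.2.re ^ 2 + y.2.im ^ 2 + y.1.im ^ 2) * h4 +
      (chainCos n ^ 2 - 1) * h3
  exact (pow_eq_one_iff_of_nonneg (norm_nonneg _) two_ne_zero).1 h1

theorem contDiffAt_boost {n : ℕ} (hn : 2 ≤ n) (k : ℕ) {y : ℂ × ℂ} (hy : y ≠ 0) :
    ContDiffAt ℝ ∞ (boost n k) y := by
  have a1 : ContDiffAt ℝ ∞ (fun y : ℂ × ℂ => y.1.re) y :=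
    (Complex.reCLM.contDiff.comp contDiff_fst).contDiffAt
  have a2 : ContDiffAt ℝ ∞ (fun y : ℂ × ℂ => y.1.im) y :=
    (Complex.imCLM.contDiff.comp contDiff_fst).contDiffAt
  have a3 : ContDiffAt ℝ ∞ (fun y : ℂ × ℂ => y.2.re) y :=
    (Complex.reCLM.contDiff.comp contDiff_snd).contDiffAt
  have a4 : ContDiffAt ℝ ∞ (fun y : ℂ × ℂ => y.2.im) y :=
    (Complex.imCLM.contDiff.comp contDiff_snd).contDiffAt
  have b1 : ContDiffAt ℝ ∞ pairNorm y :=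
    (((a1.pow 2).add (a2.pow 2)).add ((a3.pow 2).add (a4.pow 2))).sqrt (pairNorm_arg_pos hy).ne'
  have b2 : ContDiffAt ℝ ∞ (boostDen n) y := b1.add (contDiffAt_const.mul a1)
  have b3 := (boostDen_pos hn hy).ne'
  have cast : ∀ {f : ℂ × ℂ → ℝ}, ContDiffAt ℝ ∞ f y → ContDiffAt ℝ ∞ (fun y => (f y : ℂ)) y :=
    fun hf => Complex.ofRealCLM.contDiff.contDiffAt.comp y hf
  rw [contDiffAt_piLp]
  intro i
  fin_cases i
  · exact ((cast ((a1.add (contDiffAt_const.mul b1)).div b2 b3)).add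
      ((cast ((contDiffAt_const.mul a3).div b2 b3)).mul contDiffAt_const)).mul contDiffAt_const
  · exact ((cast ((contDiffAt_const.mul a4).div b2 b3)).add
      ((cast ((contDiffAt_const.mul a2).div b2 b3)).mul contDiffAt_const)).mul contDiffAt_const

/-- Subtracting `chainCos n` times the denominator cancels the time coordinate and leaves `(1 -
chainCos n ^ 2) * y.1.re`. So the chain function vanishes exactly on `y.1 = 0`. -/
theorem chainFun_boost {n : ℕ} (hn : 2 ≤ n) (k : ℕ) {y : ℂ × ℂ} (hy : y ≠ 0) :
    chainLin n k (boost n k y) - (chainCos n : ℝ) =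
      ((chainSin n / boostDen n y : ℝ) : ℂ) * ⟨chainSin n * y.1.re, y.1.im⟩ := by
  rw [chainLin_apply, boost_zero_mul, boost_one_mul]
  have h2 := (boostDen_pos hn hy).ne'
  have h4 := chainSin_sq hn
  apply Complex.ext
  · simp only [Complex.sub_re, Complex.ofReal_re, Complex.re_ofReal_mul]
    field_simp
    unfold boostDen
    linear_combination (-y.1.re) * h4
  · simp only [Complex.sub_im, Complex.ofReal_im, Complex.im_ofReal_mul]
    ring

/-- The coordinates along the plane of the `k`-th component of the chain. -/
def chainColin (n k : ℕ) : C2 →L[ℝ] ℂ :=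
  LinearMap.toContinuousLinearMap
    { toFun := fun x => ⟨(x 0 * Complex.exp (-(k * Real.pi / n * Complex.I))).im,
        (x 1 * Complex.I ^ k).re⟩
      map_add' := fun x y => by apply Complex.ext <;> simp [add_mul]
      map_smul' := fun c x => by apply Complex.ext <;> simp [mul_assoc, mul_add, mul_sub] }

theorem chainColin_apply (n k : ℕ) (x : C2) :
    chainColin n k x = ⟨(x 0 * Complex.exp (-(k * Real.pi / n * Complex.I))).im,
      (x 1 * Complex.I ^ k).re⟩ := rfl

theorem chainColin_boost (n k : ℕ) (y : ℂ × ℂ) :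
    chainColin n k (boost n k y) = ((chainSin n / boostDen n y : ℝ) : ℂ) * y.2 := by
  rw [chainColin_apply, boost_zero_mul, boost_one_mul]
  apply Complex.ext
  · simp only [Complex.re_ofReal_mul]; ring
  · simp only [Complex.im_ofReal_mul]; ring

theorem coords_ext {n k : ℕ} {x y : C2} (h1 : chainLin n k x = chainLin n k y)
    (h2 : chainColin n k x = chainColin n k y) : x = y := by
  rw [chainLin_apply, chainLin_apply, Complex.mk.injEq] at h1
  rw [chainColin_apply, chainColin_apply, Complex.mk.injEq] at h2
  ext i
  fin_cases i
  · exact mul_right_cancel₀ (Complex.exp_ne_zero _) (Complex.ext h1.1 h2.1)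
  · exact mul_right_cancel₀ (pow_ne_zero k Complex.I_ne_zero) (Complex.ext h2.2 h1.2)

/-- A left inverse of the explicit tubes, up to a linear map. -/
def boostInv (n k : ℕ) (x : C2) : ℂ × ℂ :=
  ((‖chainColin n k x‖⁻¹ : ℝ) * (chainLin n k x - (chainCos n : ℝ)),
    (‖chainColin n k x‖⁻¹ : ℝ) * chainColin n k x)

/-- Both coordinates carry the same positive factor, and since `v` has norm one this factor is the
norm of `chainColin`. -/
theorem boostInv_boost {n : ℕ} (hn : 2 ≤ n) (k : ℕ) (u : ℂ) (v : Circle) :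
    boostInv n k (boost n k (u, v)) = (⟨chainSin n * u.re, u.im⟩, (v : ℂ)) := by
  have hy : ((u, (v : ℂ)) : ℂ × ℂ) ≠ 0 := fun h => v.coe_ne_zero (Prod.mk_eq_zero.1 h).2
  have hpos : 0 < chainSin n / boostDen n (u, v) := div_pos (chainSin_pos hn) (boostDen_pos hn hy)
  rw [boostInv, chainFun_boost hn k hy, chainColin_boost, norm_mul, Circle.norm_coe, mul_one,
    Complex.norm_real, Real.norm_of_nonneg hpos.le]
  generalize chainSin n / boostDen n (u, v) = s at *
  have : (s : ℂ) ≠ 0 := by exact_mod_cast hpos.ne'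
  simp only [Complex.ofReal_inv, inv_mul_cancel_left₀ this]

theorem differentiableAt_boostInv {n k : ℕ} {x : C2} (hx : chainColin n k x ≠ 0) :
    DifferentiableAt ℝ (boostInv n k) x := by
  have h1 : DifferentiableAt ℝ (chainColin n k) x := (chainColin n k).differentiableAt
  have h2 : DifferentiableAt ℝ (chainLin n k) x := (chainLin n k).differentiableAt
  have h3 : DifferentiableAt ℝ (fun x => ((‖chainColin n k x‖⁻¹ : ℝ) : ℂ)) x :=
    Complex.ofRealCLM.differentiableAt.comp x ((h1.norm ℝ hx).inv (norm_ne_zero_iff.2 hx))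
  exact (h3.mul (h2.sub_const _)).prodMk (h3.mul h1)

theorem pair_ne_zero (u : ℂ) (v : Circle) : ((u, (v : ℂ)) : ℂ × ℂ) ≠ 0 := fun h =>
  v.coe_ne_zero (Prod.mk_eq_zero.1 h).2

/-- The explicit tube of size `ε` around the `k`-th component of the chain. -/
def boostTube {n : ℕ} (hn : 2 ≤ n) (k : ℕ) (ε : ℝ) (y : ℂ × Circle) : S3 :=
  ⟨boost n k (ε * y.1, y.2), mem_sphere_zero_iff_norm.2 (norm_boost hn k (pair_ne_zero _ _))⟩

section

variable {n : ℕ} (hn : 2 ≤ n) (k : ℕ) {ε : ℝ}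

theorem contDiff_boostTube :
    ContDiff ℝ ∞ (fun y : ℂ × ℝ => (boostTube hn k ε (y.1, Circle.exp y.2) : C2)) := by
  rw [contDiff_iff_contDiffAt]
  intro y
  refine (contDiffAt_boost hn k (pair_ne_zero (ε * y.1) (Circle.exp y.2))).comp
    (f := fun y : ℂ × ℝ => ((ε * y.1, (Circle.exp y.2 : ℂ)) : ℂ × ℂ)) y ?_
  have h1 : ContDiff ℝ ∞ (fun y : ℂ × ℝ => (Circle.exp y.2 : ℂ)) := by
    simp only [Circle.coe_exp]
    exact ((Complex.ofRealCLM.contDiff.comp contDiff_snd).mul contDiff_const).cexp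
  exact ((contDiff_const.mul contDiff_fst).prodMk h1).contDiffAt

theorem chainColin_boostTube_ne_zero (y : ℂ × Circle) :
    chainColin n k (boostTube hn k ε y : C2) ≠ 0 := by
  simp only [boostTube]
  rw [chainColin_boost]
  refine mul_ne_zero ?_ y.2.coe_ne_zero
  exact_mod_cast (div_pos (chainSin_pos hn) (boostDen_pos hn (pair_ne_zero _ _))).ne'

theorem boostInv_boostTube (y : ℂ × Circle) :
    boostInv n k (boostTube hn k ε y : C2) =
      ((⟨chainSin n * (ε * y.1.re), ε * y.1.im⟩, y.2) : ℂ × ℂ) := by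
  simp only [boostTube]
  rw [boostInv_boost hn]
  simp

theorem injective_boostTube (hε : 0 < ε) : Function.Injective (boostTube hn k ε) := by
  intro y y' h
  have h1 := boostInv_boostTube hn k (ε := ε) y
  rw [h, boostInv_boostTube, Prod.mk.injEq, Complex.mk.injEq] at h1
  have hs := (chainSin_pos hn).ne'
  refine Prod.ext (Complex.ext ?_ ?_) (Circle.ext h1.2.symm)
  · exact (mul_left_cancel₀ hε.ne' (mul_left_cancel₀ hs h1.1.1)).symm
  · exact (mul_left_cancel₀ hε.ne' h1.1.2).symm

/-- A tangent vector killed by the derivative is also killed after composition with `boostInv`,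
which turns the tube into an explicit map that is visibly an immersion. -/
theorem immersion_boostTube (hε : 0 < ε) (y : ℂ × ℝ) : Function.Injective
    (fderiv ℝ (fun y : ℂ × ℝ => (boostTube hn k ε (y.1, Circle.exp y.2) : C2)) y) := by
  set φ := fun y : ℂ × ℝ => (boostTube hn k ε (y.1, Circle.exp y.2) : C2) with hφ
  rw [injective_iff_map_eq_zero]
  rintro ⟨a, τ⟩ h
  have hφd : HasFDerivAt φ (fderiv ℝ φ y) y :=
    ((contDiff_boostTube hn k).differentiable (by simp)).differentiableAt.hasFDerivAt
  have hcurve : HasDerivAt (fun t : ℝ => y + t • ((a, τ) : ℂ × ℝ)) (a, τ) 0 := by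
    simpa using ((hasDerivAt_id (0 : ℝ)).smul_const ((a, τ) : ℂ × ℝ)).const_add y
  have hG : DifferentiableAt ℝ (boostInv n k) (φ y) :=
    differentiableAt_boostInv (chainColin_boostTube_ne_zero hn k _)
  have h1 : HasDerivAt (fun t : ℝ => boostInv n k (φ (y + t • ((a, τ) : ℂ × ℝ)))) 0 0 := by
    have e1 : HasFDerivAt (boostInv n k ∘ φ) ((fderiv ℝ (boostInv n k) (φ y)).comp (fderiv ℝ φ y))
        (y + (0 : ℝ) • ((a, τ) : ℂ × ℝ)) := by
      rw [zero_smul, add_zero]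
      exact hG.hasFDerivAt.comp y hφd
    exact (e1.comp_hasDerivAt (0 : ℝ) hcurve).congr_deriv (by
      rw [ContinuousLinearMap.comp_apply, h, map_zero])
  have h2 : (fun t : ℝ => boostInv n k (φ (y + t • ((a, τ) : ℂ × ℝ)))) = fun t : ℝ =>
      ((⟨chainSin n * (ε * (y.1.re + t * a.re)), ε * (y.1.im + t * a.im)⟩,
        Complex.exp (((y.2 + t * τ : ℝ) : ℂ) * Complex.I)) : ℂ × ℂ) := by
    funext t
    simp only [hφ]
    rw [boostInv_boostTube]
    simp [add_mul, Complex.exp_add]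
  rw [h2] at h1
  have h3 : HasDerivAt (fun t : ℝ => chainSin n * (ε * (y.1.re + t * a.re))) 0 0 :=
    (Complex.reCLM.hasFDerivAt.comp_hasDerivAt (0 : ℝ) h1.fst)
  have h4 : HasDerivAt (fun t : ℝ => ε * (y.1.im + t * a.im)) 0 0 :=
    (Complex.imCLM.hasFDerivAt.comp_hasDerivAt (0 : ℝ) h1.fst)
  have h5 : HasDerivAt (fun t : ℝ => Complex.exp (((y.2 + t * τ : ℝ) : ℂ) * Complex.I)) 0 0 :=
    h1.snd
  have aff : ∀ c d : ℝ, HasDerivAt (fun t : ℝ => c + t * d) d 0 := fun c d => by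
    simpa using ((hasDerivAt_id (0 : ℝ)).mul_const d).const_add c
  have h6 := h3.unique (((aff _ _).const_mul ε).const_mul (chainSin n))
  have h7 := h4.unique ((aff _ _).const_mul ε)
  have h8 := h5.unique (((aff y.2 τ).ofReal_comp.mul_const Complex.I).cexp)
  have hs := (chainSin_pos hn).ne'
  have g1 : a.re = 0 := by simpa [hs, hε.ne'] using h6.symm
  have g2 : a.im = 0 := by simpa [hε.ne'] using h7.symm
  have g3 : τ = 0 := by simpa using h8.symm
  exact Prod.ext (Complex.ext g1 g2) g3

theorem chainFun_boostTube_eq_zero_iff (hε : 0 < ε) (y : ℂ × Circle) :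
    chainFun n k (boostTube hn k ε y) = 0 ↔ y.1 = 0 := by
  have hy := pair_ne_zero (ε * y.1) y.2
  have hs := chainSin_pos hn
  have h1 : chainFun n k (boostTube hn k ε y) =
      chainLin n k (boost n k (ε * y.1, y.2)) - (chainCos n : ℝ) := chainFun_eq n k _
  rw [h1, chainFun_boost hn k hy, mul_eq_zero]
  have h2 : ((chainSin n / boostDen n (ε * y.1, y.2) : ℝ) : ℂ) ≠ 0 := by
    exact_mod_cast (div_pos hs (boostDen_pos hn hy)).ne'
  rw [or_iff_right h2]
  simp [Complex.ext_iff, hs.ne', hε.ne']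

theorem range_boostTube_core (hε : 0 < ε) :
    Set.range (fun v : Circle => boostTube hn k ε (0, v)) = {x | chainFun n k x = 0} := by
  ext x
  constructor
  · rintro ⟨v, rfl⟩
    exact (chainFun_boostTube_eq_zero_iff hn k hε (0, v)).2 rfl
  · intro hx
    have hs := chainSin_pos hn
    have hx1 : chainLin n k x = (chainCos n : ℝ) := by
      have h : chainFun n k x = 0 := hx
      rw [chainFun_eq] at h
      exact sub_eq_zero.1 h
    -- A component is the full circle of radius `chainSin n` in its plane, so the direction of
    -- `chainColin` determines the point.
    have hx2 : ‖chainColin n k x‖ = chainSin n := by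
      have h1 := norm_sq_rotate n k x
      have h2 := hx1
      rw [mem_sphere_zero_iff_norm.1 x.2, ← Complex.normSq_eq_norm_sq,
        ← Complex.normSq_eq_norm_sq, Complex.normSq_apply, Complex.normSq_apply] at h1
      rw [chainLin_apply, Complex.ext_iff] at h2
      simp only [Complex.ofReal_re, Complex.ofReal_im] at h2
      rw [h2.1, h2.2] at h1
      have h3 : ‖chainColin n k x‖ ^ 2 = chainSin n ^ 2 := by
        rw [chainSin_sq hn, ← Complex.normSq_eq_norm_sq, Complex.normSq_apply, chainColin_apply]
        simp only
        linarith
      exact (pow_left_inj₀ (norm_nonneg _) hs.le two_ne_zero).1 h3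
    refine ⟨dir (chainColin n k x), Subtype.ext ?_⟩
    have hy := pair_ne_zero 0 (dir (chainColin n k x))
    have he : (boostTube hn k ε (0, dir (chainColin n k x)) : C2) =
        boost n k (0, dir (chainColin n k x)) := by
      simp [boostTube]
    refine coords_ext (n := n) (k := k) ?_ ?_
    · rw [hx1]
      have h7 := chainFun_boost hn k hy
      have h8 : (⟨chainSin n * (0 : ℂ).re, (0 : ℂ).im⟩ : ℂ) = 0 := by
        apply Complex.ext <;> simp
      rw [h8, mul_zero] at h7
      exact (congrArg (chainLin n k) he).trans (sub_eq_zero.1 h7)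
    · refine (congrArg (chainColin n k) he).trans ((chainColin_boost n k _).trans ?_)
      rw [boostDen_zero, div_one, ← hx2]
      exact norm_mul_dir _

/-- The longitude extends from the circle to all `v ∈ ℂ` at the fixed first coordinate `ε ≠ 0`,
where the chain function does not vanish. As `ℂ` is simply connected, the loop is null-homotopic off
the component. -/
theorem nullHomologousIn_boostTube (hε : 0 < ε) :
    NullHomologousIn {x | chainFun n k x = 0}ᶜ fun v => boostTube hn k ε (1, v) := by
  have hy : ∀ v : ℂ, ((ε : ℂ), v) ≠ 0 := fun v h => by
    have := (Prod.mk_eq_zero.1 h).1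
    exact hε.ne' (by exact_mod_cast this)
  let f : ℂ → S3 := fun v => ⟨boost n k (ε, v), mem_sphere_zero_iff_norm.2 (norm_boost hn k (hy v))⟩
  have hf : Continuous f := by
    refine Continuous.subtype_mk (continuous_iff_continuousAt.2 fun v => ?_) _
    exact (contDiffAt_boost hn k (hy v)).continuousAt.comp (f := fun v : ℂ => ((ε : ℂ), v))
      (by fun_prop)
  have hmem : ∀ v, f v ∈ ({x | chainFun n k x = 0}ᶜ : Set S3) := by
    intro v h
    have h1 : chainFun n k (f v) = 0 := h
    rw [chainFun_eq] at h1
    have h2 := (chainFun_boost hn k (hy v)).symm.trans h1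
    rcases mul_eq_zero.1 h2 with h3 | h3
    · exact (div_pos (chainSin_pos hn) (boostDen_pos hn (hy v))).ne' (by exact_mod_cast h3)
    · have h4 := congrArg Complex.re h3
      simp [(chainSin_pos hn).ne', hε.ne'] at h4
  let F : ℂ → ({x | chainFun n k x = 0}ᶜ : Set S3) := fun v => ⟨f v, hmem v⟩
  have hF : Continuous F := hf.subtype_mk _
  let c : Path (1 : ℂ) 1 :=
    { toFun := fun t => (Circle.exp (2 * Real.pi * t) : ℂ)
      continuous_toFun := by fun_prop
      source' := by simp
      target' := by simp }
  have hc : c.Homotopic (Path.refl 1) := SimplyConnectedSpace.paths_homotopic _ _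
  refine ⟨F 1, c.map hF, fun t => ?_, ?_⟩
  · apply Subtype.ext
    simp [F, f, c, boostTube]
  · have h1 : (c.map hF).Homotopic ((Path.refl 1).map hF) := hc.map ⟨F, hF⟩
    have h3 : (Path.refl (1 : ℂ)).map hF = Path.refl (F 1) := rfl
    rw [h3] at h1
    have h2 : Path.Homotopic.Quotient.mk (c.map hF) = Path.Homotopic.Quotient.mk (Path.refl _) :=
      Path.Homotopic.Quotient.eq.2 h1
    rw [h2]
    exact map_one _

end

theorem boostTube_eq {n : ℕ} (hn : 2 ≤ n) (k : ℕ) (ε : ℝ) (y : ℂ × Circle) :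
    boostTube hn k ε y = boostTube hn k 1 (ε * y.1, y.2) := by
  simp [boostTube]

/-- At size zero the tubes shrink to the disjoint components. Compactness of the torus of core
parameters and finiteness of the set of pairs keep them disjoint for small sizes. -/
theorem nonempty_tubeSystem {n : ℕ} (hn : 2 ≤ n) : Nonempty (TubeSystem (chainLink n)) := by
  have : NeZero (2 * n) := ⟨by omega⟩
  have hcont : ∀ k, Continuous (boostTube hn k 1) := fun k => by
    rw [continuous_comp_circleExp_iff, continuous_induced_rng]
    exact (contDiff_boostTube hn k).continuous
  have hcore : ∀ (j : ZMod (2 * n)) (v : Circle), boostTube hn j.val 1 (0, v) ∈ chainLink n j :=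
    fun j v => (chainFun_boostTube_eq_zero_iff hn j.val one_pos (0, v)).2 rfl
  have hev : ∀ᶠ w : ℂ × ℂ in nhds 0, ∀ j k : ZMod (2 * n), j ≠ k → ∀ y : Circle × Circle,
      boostTube hn j.val 1 (w.1, y.1) ≠ boostTube hn k.val 1 (w.2, y.2) := by
    simp only [Filter.eventually_all]
    intro j k hjk
    have h := IsCompact.eventually_forall_of_forall_eventually (x₀ := (0 : ℂ × ℂ))
      (K := (Set.univ : Set (Circle × Circle))) isCompact_univ
      (P := fun w y => boostTube hn j.val 1 (w.1, y.1) ≠ boostTube hn k.val 1 (w.2, y.2)) ?_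
    · simpa using h
    · intro y _
      have ho : IsOpen {z : (ℂ × ℂ) × (Circle × Circle) |
          boostTube hn j.val 1 (z.1.1, z.2.1) ≠ boostTube hn k.val 1 (z.1.2, z.2.2)} :=
        isOpen_ne_fun ((hcont j.val).comp (by fun_prop)) ((hcont k.val).comp (by fun_prop))
      refine ho.mem_nhds fun he => ?_
      exact Set.disjoint_left.1 (disjoint_chainLink hn hjk) (hcore j y.1)
        (by rw [show boostTube hn j.val 1 (0, y.1) = _ from he]; exact hcore k y.2)
  obtain ⟨δ, hδ, hball⟩ := Metric.eventually_nhds_iff.1 hev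
  -- The half makes the closed tubes fit into the open ball of radius `δ`.
  have hε : 0 < δ / 2 := by positivity
  refine ⟨{
    tube := fun j => boostTube hn j.val (δ / 2)
    smooth := fun j => contDiff_boostTube hn j.val
    immersion := fun j => immersion_boostTube hn j.val hε
    injective := fun j => injective_boostTube hn j.val hε
    core := fun j => range_boostTube_core hn j.val hε
    disjoint := ?_
    preferred := fun j => nullHomologousIn_boostTube hn j.val hε }⟩
  intro j k hjk
  rw [Set.disjoint_left]
  rintro _ ⟨⟨u, v⟩, ⟨hu, -⟩, rfl⟩ ⟨⟨u', v'⟩, ⟨hu', -⟩, he⟩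
  rw [boostTube_eq, boostTube_eq hn j.val] at he
  have hlt : ∀ u : ℂ, u ∈ Metric.closedBall (0 : ℂ) 1 → ‖((δ / 2 : ℝ) : ℂ) * u‖ < δ := by
    intro u hu
    rw [norm_mul, Complex.norm_real, Real.norm_of_nonneg hε.le]
    nlinarith [mem_closedBall_zero_iff.1 hu]
  refine hball (y := (((δ / 2 : ℝ) : ℂ) * u, ((δ / 2 : ℝ) : ℂ) * u')) ?_ j k hjk (v, v') he.symm
  rw [dist_zero_right, Prod.norm_mk]
  exact max_lt (hlt u hu) (hlt u' hu')

end

theorem mainTheorem10 (n : ℕ) (hn : 2 ≤ n) :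
    Nonempty (TubeSystem (chainLink n)) ∧
    (∀ (i : ZMod (2 * n)) (T : TubeSystem (chainLink n)),
      ∃ F : T.Surgery {i, i + 1} ≃ₜ S3,
        (∀ x : T.exterior, F (T.ofExterior {i, i + 1} x) = mlSwap n i x) ∧
        ∀ j, F '' T.coreLink {i, i + 1} j = mlSwap n i '' chainLink n j) ∧
    (∀ (l : List (ZMod (2 * n))) (L : ZMod (2 * n) → Set S3), IsNestedPartner n l L →
      ∀ T : TubeSystem (chainLink n),
        ∃ (F : T.Surgery (hopfSublink n l) ≃ₜ S3) (Φ : S3 ≃ₜ S3), IsotopicToId Φ ∧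
          (∀ x : T.exterior, F (T.ofExterior (hopfSublink n l) x) = Φ (mlSwaps n l x)) ∧
          ∀ j, F '' T.coreLink (hopfSublink n l) j = L j) := by
  have : NeZero (2 * n) := ⟨by omega⟩
  refine ⟨nonempty_tubeSystem hn, fun i T => (realizes_mlSwap hn i T).exists_homeomorph, ?_⟩
  rintro l L ⟨hl, Φ, hΦ, hL⟩ T
  obtain ⟨F, h1, h2⟩ := (realizes_mlSwaps hn T hl).exists_homeomorph
  refine ⟨F.trans Φ, Φ, hΦ, fun x => congrArg Φ (h1 x), fun j => ?_⟩
  refine Eq.trans ?_ (hL j)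
  exact (Set.image_comp Φ F _).trans (congrArg (Φ '' ·) (h2 j))
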